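/- **Notation.** Let $q\in\mathbb{C}$ with $0<|q|<1$. For $|p|<1$ put $(x;p)_\infty=\prod_{k\ge0}(1-xp^k)$, and for $x,z\in\mathbb C^*$, $0<|p|<1$, $$j(z;p)=(z;p)_\infty(p/z;p)_\infty(p;p)_\infty,\qquad m(x,p,z)=\frac1{j(z;p)}\sum_{r\in\mathbb Z}\frac{(-1)^rp^{\binom r2}z^r}{1-p^{r-1}xz},$$ where $z$ is called *generic* for $m(x,p,z)$ if neither $z$ nor $xz$ is an integral power of $p$. For integers $k$ and $n\ge1$ put $$\Psi_k^n(x,z,z';p)=-\frac{x^kz^{k+1}(p^{n^2};p^{n^2})_\infty^3}{j(z;p)\,j(z';p^{n^2})}\sum_{t=0}^{n-1}\frac{p^{\binom{t+1}2+kt}(-z)^t\,j\bigl(-p^{\binom{n+1}2+nk+nt}(-z)^n/z';p^{n^2}\bigr)\,j\bigl(p^{nt}(xz)^nz';p^{n^2}\bigr)}{j\bigl(-p^{\binom n2-nk}(-x)^nz';p^{n^2}\bigr)\,j\bigl(p^{nt}(xz)^n;p^{n^2}\bigr)} .$$ For an integer $d\ge1$ define the integers $\overline N_d(m,n)$ by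 expanding, in powers of $q$ with coefficients that are Laurent polynomials in $z$, $$\sum_{m\in\mathbb Z,\,n\ge0}\overline N_d(m,n)z^mq^n=\frac{(-q;q)_\infty}{(q;q)_\infty}\Biggl(1+2\sum_{n\ge1}\frac{(1-z)(1-z^{-1})(-1)^nq^{n^2+dn}}{(1-zq^{dn})(1-z^{-1}q^{dn})}\Biggr).$$ Let $\overline p(n)$ be the number of overpartitions of $n$ (partitions in which the first occurrence of each distinct part may be overlined), and put $$\overline D_d(a,M)=\sum_{n\ge0}\Bigl(\sum_{k\equiv a\ (\mathrm{mod}\ M)}\overline N_d(k,n)-\frac{\overline p(n)}M\Bigr)q^n .$$ **Theorem 1.2.** Let $d\ge2$ be an even integer and let $a,M$ be integers with $1\le a\le M-1$. Let $\zeta_M$ be a primitive $M$-th root of unity and, for $1\le j\le M-1$, let $\zeta_M^{2j/d}$ denote any complex number whose $\frac d2$-th power is $\zeta_M^j$. Let $z',z''\in\mathbb C^*$ be generic for the two Appell–Lerch series $m(\cdot,\cdot,z')$ and $m(\cdot,\cdot,z'')$ below. Then the series $\overline D_d(a,M)$ and $\overline D_d(a-1,M)$ converge absolutely and $$\begin{aligned}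 \overline D_d(a,M)+\overline D_d(a-1,M)={}&\chi(a=1)+2(-1)^{\frac{da}2}q^{-\frac{d^2a^2}4}\,m\Bigl((-1)^{1+\frac{dM}2}q^{\frac{d^2}4(M^2-2Ma)},q^{\frac{d^2M^2}2},z'\Bigr)\\ &+2(-1)^{\frac d2(a-1)+1}q^{-\frac{d^2}4(a^2-2a+1)}\,m\Bigl((-1)^{1+\frac{dM}2}q^{\frac{d^2}4(M^2-2M(a-1))},q^{\frac{d^2M^2}2},z''\Bigr)\\ &+2\Psi_a^M\Bigl((-1)^{\frac d2+1}q^{\frac{d^2}4},-1,z';q^{\frac{d^2}2}\Bigr)-2\Psi_{a-1}^M\Bigl((-1)^{\frac d2+1}q^{\frac{d^2}4},-1,z'';q^{\frac{d^2}2}\Bigr)\\ &+\frac2M(-1)^{\frac d2}q^{-\frac{d^2}4}\sum_{j=1}^{M-1}\zeta_M^{j-aj}(1-\zeta_M^j)\,\Psi_0^{\frac d2}\Bigl(\zeta_M^{\frac{2j}d}q^{1-d},q,-1;q^2\Bigr), \end{aligned}$$ where $\chi(a=1)$ is $1$ if $a=1$ and $0$ otherwise. -/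

import Mathlib

namespace OverpartitionRank

/-! ### Overpartitions and the generalized rank deviations -/

/-- An overpartition of `n`: a partition of `n` together with the set of those part sizes whose
first occurrence is overlined. -/
abbrev Overpartition (n : ℕ) : Type :=
  (p : n.Partition) × ↥(p.parts.toFinset.powerset)

/-- The number `p̄(n)` of overpartitions of `n`. -/
def pbar (n : ℕ) : ℕ := Fintype.card (Overpartition n)

/-- Formal power series in `q` (written `PowerSeries.X`) whose coefficients are Laurent polynomials
in `z` (written `LaurentPolynomial.T 1`). -/
abbrev QSeries : Type := PowerSeries (LaurentPolynomial ℤ)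

/-- The geometric series `1 / (1 - z ^ e * q ^ m)`, expanded in powers of `q`, for `m ≥ 1`. -/
noncomputable def geom (e : ℤ) (m : ℕ) : QSeries :=
  PowerSeries.invOfUnit (1 - PowerSeries.C (LaurentPolynomial.T e) * PowerSeries.X ^ m) 1

/-- The product `∏_{k=1}^{L} (1 + q ^ k) / (1 - q ^ k)`, a truncation of `(-q)_∞ / (q)_∞`. -/
noncomputable def prodTrunc (L : ℕ) : QSeries :=
  ∏ k ∈ Finset.Icc 1 L, (1 + PowerSeries.X ^ k) * geom 0 k

/-- The `n`-th term
`(1 - z) (1 - z⁻¹) (-1) ^ n q ^ (n ^ 2 + d n) / ((1 - z q ^ (d n)) (1 - z⁻¹ q ^ (d n)))`. -/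
noncomputable def oTerm (d n : ℕ) : QSeries :=
  PowerSeries.C ((1 - LaurentPolynomial.T 1) * (1 - LaurentPolynomial.T (-1)))
    * (-1) ^ n * PowerSeries.X ^ (n ^ 2 + d * n) * geom 1 (d * n) * geom (-1) (d * n)

/-- The truncation at `L` of the product and of the sum that define `𝒪_d(z; q)`. -/
noncomputable def oTrunc (d L : ℕ) : QSeries :=
  prodTrunc L * (1 + 2 * ∑ n ∈ Finset.Icc 1 L, oTerm d n)

/-- The formal series
`𝒪_d(z; q) = (-q)_∞ / (q)_∞ * (1 + 2 ∑_{n ≥ 1} (1 - z) (1 - z⁻¹) (-1) ^ n q ^ (n ^ 2 + d n) /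
((1 - z q ^ (d n)) (1 - z⁻¹ q ^ (d n))))`.
The factors and terms of index larger than `N` do not change the coefficient of `q ^ N`
(see `coeff_oTrunc_eq`), so that coefficient is read off the truncation at `N`. -/
noncomputable def oSeries (d : ℕ) : QSeries :=
  PowerSeries.mk fun N => PowerSeries.coeff N (oTrunc d N)

theorem geom_eq (e : ℤ) {m : ℕ} (hm : m ≠ 0) :
    geom e m = 1 + PowerSeries.X ^ m * (PowerSeries.C (LaurentPolynomial.T e) * geom e m) := by
  have h : (1 - PowerSeries.C (LaurentPolynomial.T e) * PowerSeries.X ^ m) * geom e m = 1 :=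
    PowerSeries.mul_invOfUnit _ _ (by simp [hm])
  linear_combination h

theorem dvd_oTrunc_succ_sub (d L : ℕ) :
    (PowerSeries.X : QSeries) ^ (L + 1) ∣ oTrunc d (L + 1) - oTrunc d L := by
  have h1 := geom_eq 0 (m := L + 1) (by omega)
  have h2 : prodTrunc (L + 1)
      = prodTrunc L * ((1 + PowerSeries.X ^ (L + 1)) * geom 0 (L + 1)) := by
    simp [prodTrunc, Finset.prod_Icc_succ_top]
  have h3 : ∑ n ∈ Finset.Icc 1 (L + 1), oTerm d n
      = ∑ n ∈ Finset.Icc 1 L, oTerm d n + oTerm d (L + 1) := by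
    simp [Finset.sum_Icc_succ_top]
  obtain ⟨c, hc⟩ : (PowerSeries.X : QSeries) ^ (L + 1) ∣ oTerm d (L + 1) := by
    unfold oTerm
    refine Dvd.dvd.mul_right (Dvd.dvd.mul_right (Dvd.dvd.mul_left (pow_dvd_pow _ ?_) _) _) _
    nlinarith [Nat.zero_le (d * (L + 1))]
  obtain ⟨e, he⟩ : (PowerSeries.X : QSeries) ^ (L + 1) ∣
      (1 + PowerSeries.X ^ (L + 1)) * geom 0 (L + 1) - 1 := by
    refine ⟨PowerSeries.C (LaurentPolynomial.T 0) * geom 0 (L + 1) + geom 0 (L + 1), ?_⟩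
    linear_combination h1
  unfold oTrunc
  rw [h2, h3, hc]
  refine ⟨prodTrunc L * e * (1 + 2 * (∑ n ∈ Finset.Icc 1 L, oTerm d n
    + PowerSeries.X ^ (L + 1) * c)) + prodTrunc L * (2 * c), ?_⟩
  linear_combination prodTrunc L * (1 + 2 * (∑ n ∈ Finset.Icc 1 L, oTerm d n
    + PowerSeries.X ^ (L + 1) * c)) * he

/-- The coefficient of `q ^ N` in the truncations is constant from the truncation at `N` on. -/
theorem coeff_oTrunc_eq (d : ℕ) {N L : ℕ} (h : N ≤ L) :
    PowerSeries.coeff N (oTrunc d L) = PowerSeries.coeff N (oSeries d) := by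
  induction L, h using Nat.le_induction with
  | base => simp [oSeries]
  | succ L hL ih =>
    rw [← ih, ← sub_eq_zero, ← map_sub]
    exact PowerSeries.X_pow_dvd_iff.mp (dvd_oTrunc_succ_sub d L) N (by omega)

/-- `N̄_d(k, n)`, the coefficient of `z ^ k q ^ n` in `𝒪_d(z; q)`. -/
noncomputable def Nbar (d : ℕ) (k : ℤ) (n : ℕ) : ℤ :=
  (PowerSeries.coeff n (oSeries d)).coeff k

/-- `N̄_d(a, M, n)`, the sum of `N̄_d(k, n)` over all integers `k ≡ a (mod M)`. It is a finite sum: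
only the exponents `k` of the Laurent polynomial that multiplies `q ^ n` contribute. -/
noncomputable def NbarMod (d : ℕ) (a : ℤ) (M n : ℕ) : ℤ :=
  ∑ k ∈ (PowerSeries.coeff n (oSeries d)).coeff.support with k ≡ a [ZMOD M], Nbar d k n

/-- The coefficient of `q ^ n` in the deviation: `N̄_d(a, M, n) - p̄(n) / M`. -/
noncomputable def devCoeff (d : ℕ) (a : ℤ) (M n : ℕ) : ℂ :=
  (NbarMod d a M n : ℂ) - (pbar n : ℂ) / (M : ℂ)

/-- The generalized rank deviation `D̄_d(a, M) = ∑_{n ≥ 0} (N̄_d(a, M, n) - p̄(n) / M) q ^ n`. -/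
noncomputable def Dbar (d : ℕ) (a : ℤ) (M : ℕ) (q : ℂ) : ℂ :=
  ∑' n : ℕ, devCoeff d a M n * q ^ n

/-! ### Theta functions and Appell--Lerch series -/

/-- `(x; q)_∞ = ∏_{k ≥ 0} (1 - x q ^ k)`. -/
noncomputable def qPoch (x q : ℂ) : ℂ := ∏' k : ℕ, (1 - x * q ^ k)

/-- `j(z; q) = (z; q)_∞ (q / z; q)_∞ (q; q)_∞`. -/
noncomputable def jTheta (z q : ℂ) : ℂ := qPoch z q * qPoch (q / z) q * qPoch q q

/-- The binomial coefficient `r (r - 1) / 2` for an arbitrary integer `r` (the division is exact). -/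
def choose2 (r : ℤ) : ℤ := r * (r - 1) / 2

/-- The Appell--Lerch series
`m(x, q, z) = j(z; q)⁻¹ ∑_{r ∈ ℤ} (-1) ^ r q ^ (r (r - 1) / 2) z ^ r / (1 - q ^ (r - 1) x z)`. -/
noncomputable def appellLerch (x q z : ℂ) : ℂ :=
  1 / jTheta z q *
    ∑' r : ℤ, (-1 : ℂ) ^ r * q ^ choose2 r * z ^ r / (1 - q ^ (r - 1) * x * z)

/-- The parameter `z` is generic for `m(x, q, z)`: it is non-zero, and neither `z` nor `x z` is an
integral power of `q`. -/
def Generic (x q z : ℂ) : Prop :=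
  z ≠ 0 ∧ (∀ r : ℤ, z ≠ q ^ r) ∧ ∀ r : ℤ, x * z ≠ q ^ r

/-- The function `Ψ_k^n(x, z, z'; q)`, with `z'` written `w`. The symbol `J_{n²}` of the classical
notation is `(q ^ n²; q ^ n²)_∞`. -/
noncomputable def Psi (k : ℤ) (n : ℕ) (x z w q : ℂ) : ℂ :=
  -(x ^ k * z ^ (k + 1) * qPoch (q ^ n ^ 2) (q ^ n ^ 2) ^ 3
      / (jTheta z q * jTheta w (q ^ n ^ 2))) *
    ∑ t ∈ Finset.range n,
      q ^ (choose2 (t + 1) + k * t) * (-z) ^ t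
        * (jTheta (-(q ^ (choose2 (n + 1) + n * k + n * t) * (-z) ^ n / w)) (q ^ n ^ 2)
          * jTheta (q ^ (n * t) * (x * z) ^ n * w) (q ^ n ^ 2))
        / (jTheta (-(q ^ (choose2 n - n * k) * (-x) ^ n * w)) (q ^ n ^ 2)
          * jTheta (q ^ (n * t) * (x * z) ^ n) (q ^ n ^ 2))

end OverpartitionRank

namespace OverpartitionRank

open Filter Topology

/-! ### Exponents and convergence -/

/-! Write d = 2N, let O(z) be the two-variable generating function, θ = j(q; q²), and S(z) = ∑
(-1)^n q^(n²) / (1 - z q^(dn)) over all integers n.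

Orthogonality of M-th roots of unity turns each deviation into (1/M) ∑ ζ^(-aj) O(ζ^j) over 1 ≤ j ≤ M
- 1: the term j = 0 is O(1)/M, and O(1) generates overpartitions, which is exactly what the
deviation subtracts (`hasSum_devCoeff`). Adding the deviations at a and a - 1 produces the factor 1
+ ζ^j, and pairing n with -n gives (1 + z) O(z) = (1 - z)(2 S(z)/θ - 1) (`one_add_mul_rankValue`).
This is why two consecutive deviations are added. The summand -1 averages to χ(a = 1).

The engine is `tsum_eq_appellLerch_add_Psi`, used twice. It treats a theta-like bilateral series
with denominators 1 - v^n, v = q^(r-1) x z. Splitting r - 1 modulo n gives n Lerch sums of nome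
q^(n²). Each can be moved to one common Appell–Lerch series m(X, q^(n²), w); the coefficients of
that series recombine, by the same dissection of a theta function, into j(z; q), and the correction
terms are the theta quotients of `Psi`. The first use, with n = N and nome q², writes S(z)/θ as m(±z
q^(N²), q^(2N²), -1) plus a Ψ₀ term (`rankSum_div_eq`). In the second, with n = M, averaging m(ζ^j
x, Q, -1) against ζ^(-kj) replaces 1/(1 - ζ^j v) by v^k/(1 - v^M), which is again of the required
shape (`average_appellLerch_eq`); k = a and k = a - 1 give the two remaining Appell–Lerch series.

The change of parameter (`jTheta_mul_lerchSum_sub`) is proved through Laurent coefficients: j(ay)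
L(b, by) - j(by) L(a, ay) has coefficients obeying a first-order recurrence, hence equals C y
j(aby). The constant comes from y = 1/a and the residue-type evaluation j(a) L(a, 1) = -(q; q)³,
itself a limit as a → 1. The Jacobi triple product links theta products with theta series
throughout. -/

theorem two_mul_choose2 (r : ℤ) : 2 * choose2 r = r * (r - 1) := by
  have h : (2 : ℤ) ∣ r * (r - 1) := by
    rcases Int.even_or_odd r with h | h
    · exact Dvd.dvd.mul_right h.two_dvd _
    · exact Dvd.dvd.mul_left (by obtain ⟨k, hk⟩ := h; exact ⟨k, by omega⟩) _
  exact Int.mul_ediv_cancel' h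

theorem choose2_eq_of {r s : ℤ} (h : r * (r - 1) = 2 * s) : choose2 r = s := by
  have := two_mul_choose2 r
  omega

theorem choose2_add (m n : ℤ) : choose2 (m + n) = choose2 m + choose2 n + m * n :=
  choose2_eq_of (by linear_combination -two_mul_choose2 m - two_mul_choose2 n)

theorem choose2_add_one (r : ℤ) : choose2 (r + 1) = choose2 r + r := by
  rw [choose2_add]
  simp [choose2]

theorem choose2_sub_one (r : ℤ) : choose2 (r - 1) = choose2 r - r + 1 := by
  have := choose2_add_one (r - 1)
  rw [sub_add_cancel] at this
  omega

theorem choose2_neg (r : ℤ) : choose2 (-r) = choose2 r + r :=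
  choose2_eq_of (by linear_combination -two_mul_choose2 r)

theorem choose2_one_sub (r : ℤ) : choose2 (1 - r) = choose2 r :=
  choose2_eq_of (by linear_combination -two_mul_choose2 r)

theorem choose2_zero : choose2 0 = 0 := rfl

theorem choose2_one : choose2 1 = 0 := rfl

theorem summable_nat_zpow_choose2 {ρ x : ℝ} (h0 : 0 < ρ) (h1 : ρ < 1) (hx : 0 < x) :
    Summable fun n : ℕ => ρ ^ choose2 n * x ^ (n : ℤ) := by
  refine summable_of_ratio_test_tendsto_lt_one (l := 0) one_pos
    (Eventually.of_forall fun n => by positivity) ?_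
  have h : Tendsto (fun n : ℕ => ρ ^ n * x) atTop (𝓝 (0 * x)) :=
    (tendsto_pow_atTop_nhds_zero_of_lt_one h0.le h1).mul_const x
  rw [zero_mul] at h
  refine h.congr fun n => ?_
  rw [Real.norm_of_nonneg (by positivity), Real.norm_of_nonneg (by positivity)]
  push_cast
  rw [choose2_add_one, zpow_add₀ h0.ne', zpow_add_one₀ hx.ne', zpow_natCast]
  field_simp

theorem summable_zpow_choose2 {ρ x : ℝ} (h0 : 0 < ρ) (h1 : ρ < 1) (hx : 0 < x) :
    Summable fun r : ℤ => ρ ^ choose2 r * x ^ r := by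
  refine Summable.of_nat_of_neg (summable_nat_zpow_choose2 h0 h1 hx) ?_
  -- Negating the index adds n to the quadratic exponent, so the negative half is the positive half
  -- at ρ / x.
  refine (summable_nat_zpow_choose2 h0 h1 (x := ρ / x) (by positivity)).congr fun n => ?_
  rw [choose2_neg, zpow_add₀ h0.ne', div_zpow, zpow_neg]
  ring

theorem norm_theta_term (q z : ℂ) (r : ℤ) :
    ‖(-1 : ℂ) ^ r * q ^ choose2 r * z ^ r‖ = ‖q‖ ^ choose2 r * ‖z‖ ^ r := by
  simp

theorem summable_norm_theta {q z : ℂ} (hq0 : q ≠ 0) (hq1 : ‖q‖ < 1) (hz : z ≠ 0) :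
    Summable fun r : ℤ => ‖(-1 : ℂ) ^ r * q ^ choose2 r * z ^ r‖ := by
  simp_rw [norm_theta_term]
  exact summable_zpow_choose2 (norm_pos_iff.2 hq0) hq1 (norm_pos_iff.2 hz)

/-! ### Infinite products -/

theorem summable_norm_mul_pow {q : ℂ} (hq1 : ‖q‖ < 1) (x : ℂ) :
    Summable fun k : ℕ => ‖-(x * q ^ k)‖ := by
  simp_rw [norm_neg, norm_mul, norm_pow]
  exact (summable_geometric_of_lt_one (norm_nonneg _) hq1).mul_left _

theorem hasProd_qPoch {q : ℂ} (hq1 : ‖q‖ < 1) (x : ℂ) :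
    HasProd (fun k : ℕ => 1 - x * q ^ k) (qPoch x q) := by
  have h := multipliable_one_add_of_summable (summable_norm_mul_pow hq1 x)
  simp_rw [← sub_eq_add_neg] at h
  exact h.hasProd

theorem tendsto_qPoch {q : ℂ} (hq1 : ‖q‖ < 1) (x : ℂ) :
    Tendsto (fun N : ℕ => ∏ k ∈ Finset.range N, (1 - x * q ^ k)) atTop (𝓝 (qPoch x q)) :=
  (hasProd_qPoch hq1 x).tendsto_prod_nat

theorem qPoch_ne_zero {q x : ℂ} (hq1 : ‖q‖ < 1) (h : ∀ k : ℕ, x * q ^ k ≠ 1) :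
    qPoch x q ≠ 0 := by
  have := tprod_one_add_ne_zero_of_summable (f := fun k : ℕ => -(x * q ^ k))
    (fun k => by rw [← sub_eq_add_neg]; exact sub_ne_zero.2 (h k).symm)
    (summable_norm_mul_pow hq1 x)
  simpa [qPoch, sub_eq_add_neg] using this

theorem pow_ne_one_of_norm {q : ℂ} (hq1 : ‖q‖ < 1) {k : ℕ} (hk : k ≠ 0) : q ^ k ≠ 1 := by
  intro h
  have := pow_lt_one₀ (norm_nonneg q) hq1 hk
  rw [← norm_pow, h, norm_one] at this
  exact this.false

theorem qPoch_self_ne_zero {q : ℂ} (hq1 : ‖q‖ < 1) : qPoch q q ≠ 0 :=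
  qPoch_ne_zero hq1 fun k => by
    rw [← pow_succ']; exact pow_ne_one_of_norm hq1 k.succ_ne_zero

theorem qPoch_eq_mul {q : ℂ} (hq1 : ‖q‖ < 1) (x : ℂ) :
    qPoch x q = (1 - x) * qPoch (x * q) q := by
  refine tendsto_nhds_unique ((tendsto_add_atTop_iff_nat 1).2 (tendsto_qPoch hq1 x)) ?_
  refine ((tendsto_qPoch hq1 (x * q)).const_mul (1 - x)).congr fun N => ?_
  rw [Finset.prod_range_succ', mul_comm]
  simp only [pow_zero, mul_one]
  congr 1
  exact Finset.prod_congr rfl fun k _ => by ring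

theorem continuous_qPoch {q : ℂ} (hq1 : ‖q‖ < 1) : Continuous fun x => qPoch x q := by
  rw [continuous_iff_continuousAt]
  intro v
  have hb : ∀ᶠ x in 𝓝 v, ∀ k : ℕ, ‖-(x * q ^ k)‖ ≤ (‖v‖ + 1) * ‖q‖ ^ k := by
    have : ∀ᶠ x in 𝓝 v, ‖x‖ < ‖v‖ + 1 :=
      continuous_norm.continuousAt.eventually_lt continuousAt_const (by simp)
    filter_upwards [this] with x hx k
    rw [norm_neg, norm_mul, norm_pow]
    gcongr
  have := tendsto_tprod_one_add_of_dominated_convergence (𝓕 := 𝓝 v)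
    (f := fun x k => -(x * q ^ k)) (g := fun k => -(v * q ^ k))
    ((summable_geometric_of_lt_one (norm_nonneg _) hq1).mul_left _)
    (fun k => (Continuous.tendsto (by fun_prop) v)) hb
  simpa [ContinuousAt, qPoch, sub_eq_add_neg] using this

/-! ### The Jacobi triple product -/

/-- `(q; q)_N`. -/
noncomputable def finPoch (q : ℂ) (N : ℕ) : ℂ := ∏ k ∈ Finset.range N, (1 - q ^ (k + 1))

/-- `1 / (q; q)_k`, which is zero for negative `k`. -/
noncomputable def invPoch (q : ℂ) (k : ℤ) : ℂ := if k < 0 then 0 else (finPoch q k.toNat)⁻¹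

theorem finPoch_ne_zero {q : ℂ} (hq1 : ‖q‖ < 1) (N : ℕ) : finPoch q N ≠ 0 :=
  Finset.prod_ne_zero_iff.2 fun k _ =>
    sub_ne_zero.2 (pow_ne_one_of_norm hq1 k.succ_ne_zero).symm

theorem tendsto_finPoch {q : ℂ} (hq1 : ‖q‖ < 1) :
    Tendsto (finPoch q) atTop (𝓝 (qPoch q q)) :=
  (tendsto_qPoch hq1 q).congr fun N => Finset.prod_congr rfl fun k _ => by ring

theorem invPoch_natCast (q : ℂ) (N : ℕ) : invPoch q N = (finPoch q N)⁻¹ := by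
  simp [invPoch]

theorem invPoch_mul {q : ℂ} (hq1 : ‖q‖ < 1) (k : ℤ) :
    invPoch q k * (1 - q ^ k) = invPoch q (k - 1) := by
  rcases lt_trichotomy k 0 with h | rfl | h
  · simp [invPoch, h, show k - 1 < 0 by omega]
  · simp [invPoch]
  · obtain ⟨n, rfl⟩ : ∃ n : ℕ, k = n + 1 := ⟨(k - 1).toNat, by omega⟩
    have h1 := invPoch_natCast q (n + 1)
    push_cast at h1
    rw [add_sub_cancel_right, h1, invPoch_natCast, finPoch, Finset.prod_range_succ, ← finPoch]
    have h2 := finPoch_ne_zero hq1 n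
    have h3 : (1 : ℂ) - q ^ (n + 1) ≠ 0 :=
      sub_ne_zero.2 (pow_ne_one_of_norm hq1 n.succ_ne_zero).symm
    have h4 : q ^ ((n : ℤ) + 1) = q ^ (n + 1) := by exact_mod_cast zpow_natCast q (n + 1)
    rw [h4]
    field_simp

/-- Finite form of the triple product, with q-binomial coefficients of 2N over N + n. The induction
multiplies by (1 - z q^N)(1 - q^(N+1)/z) = 1 + q^(2N+1) - q^N z - q^(N+1)/z, so it combines the
series with its two shifts. Since `invPoch` vanishes at negative arguments, the bilateral sum is
finite and needs no boundary cases. -/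
theorem hasSum_finite_triple {q z : ℂ} (hq0 : q ≠ 0) (hq1 : ‖q‖ < 1) (hz : z ≠ 0) (N : ℕ) :
    HasSum (fun n : ℤ => (-1 : ℂ) ^ n * q ^ choose2 n * z ^ n
        * (finPoch q (2 * N) * invPoch q (N - n) * invPoch q (N + n)))
      (∏ k ∈ Finset.range N, (1 - z * q ^ k) * (1 - q / z * q ^ k)) := by
  induction N with
  | zero =>
    convert! hasSum_ite_eq (0 : ℤ) (1 : ℂ) using 2 with n
    split_ifs with h
    · subst h; simp [finPoch, invPoch, choose2_zero]
    · rcases lt_or_gt_of_ne h with h | h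
      · simp [invPoch, h]
      · simp [invPoch, h]
  | succ N ih =>
    have h1 := (Equiv.subRight (1 : ℤ)).hasSum_iff.2 ih
    have h2 := (Equiv.addRight (1 : ℤ)).hasSum_iff.2 ih
    have h3 := ((ih.mul_left (1 + q ^ (2 * N + 1))).sub (h1.mul_left (q ^ N * z))).sub
      (h2.mul_left (q ^ (N + 1) * z⁻¹))
    rw [Finset.prod_range_succ]
    convert! h3 using 1
    · funext n
      simp only [Function.comp, Equiv.subRight_apply, Equiv.coe_addRight]
      have ha := invPoch_mul hq1 (N + 1 - n)
      have hb := invPoch_mul hq1 (N + 1 + n)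
      have ha' := invPoch_mul hq1 (N - n)
      have hb' := invPoch_mul hq1 (N + n)
      have e1 : finPoch q (2 * (N + 1))
          = finPoch q (2 * N) * (1 - q ^ (2 * N + 1)) * (1 - q ^ (2 * N + 2)) := by
        rw [finPoch, mul_add, mul_one, Finset.prod_range_succ, Finset.prod_range_succ, finPoch]
      rw [e1, choose2_sub_one, choose2_add_one]
      rw [show (N : ℤ) + 1 - n - 1 = N - n by ring] at ha
      rw [show (N : ℤ) + 1 + n - 1 = N + n by ring] at hb
      push_cast
      rw [show (N : ℤ) - (n - 1) = N + 1 - n by ring, show (N : ℤ) + (n - 1) = N + n - 1 by ring,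
        show (N : ℤ) - (n + 1) = N - n - 1 by ring, show (N : ℤ) + (n + 1) = N + 1 + n by ring,
        ← ha', ← hb', ← ha, ← hb]
      generalize invPoch q (N + 1 - n) = A
      generalize invPoch q (N + 1 + n) = B
      have hm : (-1 : ℂ) ≠ 0 := by norm_num
      simp only [zpow_sub₀ hq0, zpow_add₀ hq0, zpow_sub₀ hz, zpow_add₀ hz, zpow_sub₀ hm,
        zpow_add₀ hm, zpow_one, zpow_natCast, pow_succ, pow_mul']
      have hqn : q ^ n ≠ 0 := zpow_ne_zero _ hq0
      have hzn : z ^ n ≠ 0 := zpow_ne_zero _ hz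
      have hqN : q ^ N ≠ 0 := pow_ne_zero _ hq0
      generalize (-1 : ℂ) ^ n = s
      generalize q ^ choose2 n = c
      generalize q ^ n = x at *
      generalize z ^ n = y at *
      generalize q ^ N = w at *
      field_simp
      ring
    · have hqN : q ^ N ≠ 0 := pow_ne_zero _ hq0
      field_simp
      ring_nf

theorem exists_norm_le_of_tendsto {f : ℕ → ℂ} {v : ℂ} (h : Tendsto f atTop (𝓝 v)) :
    ∃ B, 0 ≤ B ∧ ∀ n, ‖f n‖ ≤ B := by
  obtain ⟨B, hB⟩ := h.norm.bddAbove_range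
  exact ⟨B, (norm_nonneg _).trans (hB ⟨0, rfl⟩), fun n => hB ⟨n, rfl⟩⟩

theorem tendsto_invPoch {q : ℂ} (hq1 : ‖q‖ < 1) (n : ℤ) :
    Tendsto (fun N : ℕ => invPoch q (N + n)) atTop (𝓝 (qPoch q q)⁻¹) := by
  have h := (tendsto_finPoch hq1).inv₀ (qPoch_self_ne_zero hq1)
  have h2 : Tendsto (fun N : ℕ => ((N : ℤ) + n).toNat) atTop atTop :=
    tendsto_atTop.2 fun b => by
      filter_upwards [eventually_ge_atTop (b + n.natAbs)] with N hN
      omega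
  refine (h.comp h2).congr' ?_
  filter_upwards [eventually_ge_atTop n.natAbs] with N hN
  simp [invPoch, show ¬ ((N : ℤ) + n < 0) by omega]

/-- The Jacobi triple product identity. -/
theorem hasSum_jTheta {q z : ℂ} (hq0 : q ≠ 0) (hq1 : ‖q‖ < 1) (hz : z ≠ 0) :
    HasSum (fun n : ℤ => (-1 : ℂ) ^ n * q ^ choose2 n * z ^ n) (jTheta z q) := by
  have hP := qPoch_self_ne_zero hq1
  obtain ⟨B₁, hB₁, h1⟩ := exists_norm_le_of_tendsto (tendsto_finPoch hq1)
  obtain ⟨B₂, hB₂, h2⟩ := exists_norm_le_of_tendsto ((tendsto_finPoch hq1).inv₀ hP)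
  have h3 : ∀ k, ‖invPoch q k‖ ≤ B₂ := fun k => by
    unfold invPoch
    split_ifs
    · simpa using hB₂
    · exact h2 _
  have hs := summable_norm_theta hq0 hq1 hz
  have key := tendsto_tsum_of_dominated_convergence (𝓕 := atTop)
    (f := fun (N : ℕ) (n : ℤ) => (-1 : ℂ) ^ n * q ^ choose2 n * z ^ n
        * (finPoch q (2 * N) * invPoch q (N - n) * invPoch q (N + n)))
    (g := fun n : ℤ => (-1 : ℂ) ^ n * q ^ choose2 n * z ^ n
        * (qPoch q q * (qPoch q q)⁻¹ * (qPoch q q)⁻¹))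
    (hs.mul_right (B₁ * B₂ * B₂)) (fun n => by
      refine Tendsto.const_mul _ (Tendsto.mul (Tendsto.mul ?_ ?_) (tendsto_invPoch hq1 n))
      · exact (tendsto_finPoch hq1).comp (tendsto_id.const_mul_atTop' two_pos)
      · exact tendsto_invPoch hq1 (-n))
    (Eventually.of_forall fun N n => by
      rw [norm_mul]
      refine mul_le_mul_of_nonneg_left ?_ (norm_nonneg _)
      rw [norm_mul, norm_mul]
      exact mul_le_mul (mul_le_mul (h1 _) (h3 _) (norm_nonneg _) hB₁) (h3 _) (norm_nonneg _)
        (by positivity))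
  simp_rw [(hasSum_finite_triple hq0 hq1 hz _).tsum_eq, Finset.prod_mul_distrib] at key
  have := tendsto_nhds_unique key ((tendsto_qPoch hq1 z).mul (tendsto_qPoch hq1 (q / z)))
  rw [tsum_mul_right, mul_inv_cancel₀ hP, one_mul] at this
  rw [jTheta, ← this, inv_mul_cancel_right₀ hP]
  exact hs.of_norm.hasSum

theorem jTheta_eq_tsum {q z : ℂ} (hq0 : q ≠ 0) (hq1 : ‖q‖ < 1) (hz : z ≠ 0) :
    jTheta z q = ∑' n : ℤ, (-1 : ℂ) ^ n * q ^ choose2 n * z ^ n :=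
  (hasSum_jTheta hq0 hq1 hz).tsum_eq.symm

theorem jTheta_zpow_mul {q z : ℂ} (hq0 : q ≠ 0) (hq1 : ‖q‖ < 1) (hz : z ≠ 0) (m : ℤ) :
    jTheta (q ^ m * z) q = (-1) ^ m * q ^ (-choose2 m) * z ^ (-m) * jTheta z q := by
  have hm : (-1 : ℂ) ≠ 0 := by norm_num
  have h := (hasSum_jTheta hq0 hq1 (mul_ne_zero (zpow_ne_zero m hq0) hz))
  refine h.unique ?_
  have h2 := ((Equiv.addRight m).hasSum_iff.2 (hasSum_jTheta hq0 hq1 hz)).mul_left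
    ((-1) ^ m * q ^ (-choose2 m) * z ^ (-m))
  convert! h2 using 2 with n
  simp only [Function.comp, Equiv.coe_addRight]
  rw [choose2_add, mul_zpow, ← zpow_mul, zpow_add₀ hm, zpow_add₀ hz, zpow_add₀ hq0, zpow_add₀ hq0,
    zpow_neg, zpow_neg, mul_comm n m]
  have e : ((-1 : ℂ) ^ m) * (-1) ^ m = 1 := by rw [← mul_zpow]; simp
  have hzm : z ^ m ≠ 0 := zpow_ne_zero _ hz
  have hqm : q ^ choose2 m ≠ 0 := zpow_ne_zero _ hq0
  field_simp
  linear_combination -e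

theorem jTheta_mul_self {q z : ℂ} (hq0 : q ≠ 0) (hq1 : ‖q‖ < 1) (hz : z ≠ 0) :
    jTheta (q * z) q = -z⁻¹ * jTheta z q := by
  have := jTheta_zpow_mul hq0 hq1 hz 1
  simpa [choose2_one] using this

theorem jTheta_inv {q z : ℂ} (hq0 : q ≠ 0) (hq1 : ‖q‖ < 1) (hz : z ≠ 0) :
    jTheta z⁻¹ q = -z⁻¹ * jTheta z q := by
  have hm : (-1 : ℂ) ≠ 0 := by norm_num
  refine (hasSum_jTheta hq0 hq1 (inv_ne_zero hz)).unique ?_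
  have h2 := ((Equiv.subLeft (1 : ℤ)).hasSum_iff.2 (hasSum_jTheta hq0 hq1 hz)).mul_left (-z⁻¹)
  convert! h2 using 2 with n
  simp only [Function.comp, Equiv.subLeft_apply]
  rw [choose2_one_sub, zpow_sub₀ hm, zpow_sub₀ hz, inv_zpow]
  have e : ((-1 : ℂ) ^ n) * (-1) ^ n = 1 := by rw [← mul_zpow]; simp
  have hzm : z ^ n ≠ 0 := zpow_ne_zero _ hz
  have hmn : (-1 : ℂ) ^ n ≠ 0 := zpow_ne_zero _ hm
  simp only [zpow_one]
  field_simp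
  linear_combination e

theorem jTheta_one (q : ℂ) : jTheta 1 q = 0 := by
  have : qPoch 1 q = 0 := tprod_of_exists_eq_zero ⟨0, by simp⟩
  simp [jTheta, this]

theorem jTheta_ne_zero {q z : ℂ} (hq0 : q ≠ 0) (hq1 : ‖q‖ < 1) (hz : z ≠ 0)
    (h : ∀ r : ℤ, z ≠ q ^ r) : jTheta z q ≠ 0 := by
  refine mul_ne_zero (mul_ne_zero ?_ ?_) (qPoch_self_ne_zero hq1)
  · refine qPoch_ne_zero hq1 fun k hk => h (-k) ?_
    rw [zpow_neg, zpow_natCast]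
    exact eq_inv_of_mul_eq_one_left hk
  · refine qPoch_ne_zero hq1 fun k hk => h (k + 1) ?_
    rw [zpow_add_one₀ hq0, zpow_natCast]
    field_simp at hk
    linear_combination -hk

theorem continuousAt_jTheta {q v : ℂ} (hq1 : ‖q‖ < 1) (hv : v ≠ 0) :
    ContinuousAt (fun z => jTheta z q) v := by
  unfold jTheta
  have h := continuous_qPoch hq1
  refine ContinuousAt.mul (ContinuousAt.mul h.continuousAt ?_) continuousAt_const
  exact ContinuousAt.comp (f := fun z => q / z) (g := fun x => qPoch x q) h.continuousAt
    (continuousAt_const.div continuousAt_id hv)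

/-! ### Dependence of Appell--Lerch series on the elliptic parameter -/

/-- The bilateral series `∑ (-1) ^ r q ^ (r (r - 1) / 2) z ^ r / (1 - q ^ (r - 1) u)`. -/
noncomputable def lerchSum (q u z : ℂ) : ℂ :=
  ∑' r : ℤ, (-1 : ℂ) ^ r * q ^ choose2 r * z ^ r / (1 - q ^ (r - 1) * u)

theorem appellLerch_eq_lerchSum (x q z : ℂ) :
    appellLerch x q z = 1 / jTheta z q * lerchSum q (x * z) z := by
  simp only [appellLerch, lerchSum, mul_assoc]

theorem one_sub_zpow_mul_ne_zero {q u : ℂ} (h : ∀ r : ℤ, u ≠ q ^ r) (r : ℤ) :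
    1 - q ^ r * u ≠ 0 := by
  intro h0
  refine h (-r) ?_
  rw [zpow_neg]
  exact eq_inv_of_mul_eq_one_right (sub_eq_zero.1 h0).symm

/-- The inverses tend to 1 as r → ∞ and to 0 as r → -∞, and convergent sequences are bounded. A
vanishing denominator is harmless, since its inverse is 0. -/
theorem exists_norm_inv_le {q u : ℂ} (hq0 : q ≠ 0) (hq1 : ‖q‖ < 1) (hu : u ≠ 0) :
    ∃ B, 0 ≤ B ∧ ∀ r : ℤ, ‖(1 - q ^ r * u)⁻¹‖ ≤ B := by
  have hq := tendsto_pow_atTop_nhds_zero_of_norm_lt_one hq1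
  obtain ⟨B₁, h1, h1'⟩ : ∃ B, 0 ≤ B ∧ ∀ n : ℕ, ‖(1 - q ^ n * u)⁻¹‖ ≤ B := by
    refine exists_norm_le_of_tendsto (v := (1 - 0 * u)⁻¹) ?_
    exact (tendsto_const_nhds.sub (hq.mul_const u)).inv₀ (by simp)
  obtain ⟨B₂, h2, h2'⟩ : ∃ B, 0 ≤ B ∧ ∀ n : ℕ, ‖q ^ n * (q ^ n - u)⁻¹‖ ≤ B := by
    refine exists_norm_le_of_tendsto (v := 0 * (0 - u)⁻¹) ?_
    exact hq.mul ((hq.sub_const u).inv₀ (by simpa))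
  refine ⟨B₁ + B₂, by positivity, fun r => ?_⟩
  obtain ⟨n, rfl | rfl⟩ := r.eq_nat_or_neg
  · rw [zpow_natCast]; linarith [h1' n]
  · have : (1 - q ^ (-(n : ℤ)) * u)⁻¹ = q ^ n * (q ^ n - u)⁻¹ := by
      have hn : q ^ n ≠ 0 := pow_ne_zero _ hq0
      rw [zpow_neg, zpow_natCast, ← inv_inv (q ^ n * _), mul_inv, inv_inv]
      congr 1
      field_simp
    rw [this]; linarith [h2' n]

theorem summable_norm_lerchSum {q u z : ℂ} (hq0 : q ≠ 0) (hq1 : ‖q‖ < 1) (hu : u ≠ 0)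
    (hz : z ≠ 0) :
    Summable fun r : ℤ => ‖(-1 : ℂ) ^ r * q ^ choose2 r * z ^ r / (1 - q ^ (r - 1) * u)‖ := by
  obtain ⟨B, hB, h⟩ := exists_norm_inv_le hq0 hq1 hu
  refine ((summable_norm_theta hq0 hq1 hz).mul_right B).of_nonneg_of_le
    (fun _ => norm_nonneg _) fun r => ?_
  rw [div_eq_mul_inv, norm_mul]
  exact mul_le_mul_of_nonneg_left (h _) (norm_nonneg _)

/-- Up to sign, the coefficient of `y ^ N` in `j(a y; q) * lerchSum q b (b y)`. -/
noncomputable def crossCoeff (q a b : ℂ) (N : ℤ) : ℂ :=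
  ∑' r : ℤ, q ^ (choose2 (N - r) + choose2 r) * a ^ (N - r) * b ^ r / (1 - q ^ (r - 1) * b)

/-- The bijection `(N, r) ↦ (N - r, r)`. -/
def antidiagEquiv : ℤ × ℤ ≃ ℤ × ℤ where
  toFun p := (p.1 - p.2, p.2)
  invFun p := (p.1 + p.2, p.2)
  left_inv p := by simp
  right_inv p := by simp

theorem hasSum_crossCoeff_term {q a b y : ℂ} (hq0 : q ≠ 0) (hq1 : ‖q‖ < 1) (ha : a ≠ 0)
    (hb : b ≠ 0) (hy : y ≠ 0) :
    HasSum (fun p : ℤ × ℤ => (-1 : ℂ) ^ p.1 * y ^ p.1 *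
        (q ^ (choose2 (p.1 - p.2) + choose2 p.2) * a ^ (p.1 - p.2) * b ^ p.2
          / (1 - q ^ (p.2 - 1) * b)))
      (jTheta (a * y) q * lerchSum q b (b * y)) := by
  have h1 := summable_norm_theta hq0 hq1 (mul_ne_zero ha hy)
  have h2 := summable_norm_lerchSum hq0 hq1 hb (mul_ne_zero hb hy)
  have h3 := (summable_mul_of_summable_norm h1 h2).hasSum
  rw [← tsum_mul_tsum_of_summable_norm h1 h2, ← jTheta_eq_tsum hq0 hq1 (mul_ne_zero ha hy)] at h3
  rw [← antidiagEquiv.hasSum_iff] at h3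
  convert! h3 using 2 with p
  obtain ⟨N, r⟩ := p
  simp only [Function.comp, antidiagEquiv, Equiv.coe_fn_mk]
  have hm : (-1 : ℂ) ≠ 0 := by norm_num
  obtain ⟨m, rfl⟩ : ∃ m, N = m + r := ⟨N - r, by ring⟩
  rw [add_sub_cancel_right, zpow_add₀ hm, zpow_add₀ hy, zpow_add₀ hq0, mul_zpow, mul_zpow]
  ring

theorem hasSum_crossCoeff {q a b y : ℂ} (hq0 : q ≠ 0) (hq1 : ‖q‖ < 1) (ha : a ≠ 0)
    (hb : b ≠ 0) (hy : y ≠ 0) :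
    HasSum (fun N : ℤ => (-1 : ℂ) ^ N * y ^ N * crossCoeff q a b N)
      (jTheta (a * y) q * lerchSum q b (b * y)) := by
  have h := hasSum_crossCoeff_term hq0 hq1 ha hb hy
  convert! h.prod_fiberwise fun N => (h.summable.prod_factor N).hasSum using 2 with N
  rw [crossCoeff, ← tsum_mul_left]

theorem summable_crossCoeff_term {q a b : ℂ} (hq0 : q ≠ 0) (hq1 : ‖q‖ < 1) (ha : a ≠ 0)
    (hb : b ≠ 0) (N : ℤ) :
    Summable fun r : ℤ => q ^ (choose2 (N - r) + choose2 r) * a ^ (N - r) * b ^ r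
      / (1 - q ^ (r - 1) * b) := by
  have h := (hasSum_crossCoeff_term hq0 hq1 ha hb one_ne_zero).summable.prod_factor N
  have h2 := h.mul_left ((-1) ^ N)
  refine h2.congr fun r => ?_
  rw [one_zpow, mul_one, ← mul_assoc, ← mul_zpow]
  simp

theorem summable_theta_mul_theta {q a b : ℂ} (hq0 : q ≠ 0) (hq1 : ‖q‖ < 1) (ha : a ≠ 0)
    (hb : b ≠ 0) (N : ℤ) :
    Summable fun r : ℤ => q ^ (choose2 (N - r) + choose2 r) * a ^ (N - r) * b ^ r := by
  have h1 := summable_norm_theta hq0 hq1 ha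
  have h2 := summable_norm_theta hq0 hq1 hb
  have h3 := summable_mul_of_summable_norm h1 h2
  rw [← antidiagEquiv.summable_iff] at h3
  have h4 := (h3.prod_factor N).mul_left ((-1) ^ N)
  refine h4.congr fun r => ?_
  simp only [Function.comp, antidiagEquiv, Equiv.coe_fn_mk]
  have hm : (-1 : ℂ) ≠ 0 := by norm_num
  obtain ⟨m, rfl⟩ : ∃ m, N = m + r := ⟨N - r, by ring⟩
  rw [add_sub_cancel_right, zpow_add₀ hm, zpow_add₀ hq0]
  have e (k : ℤ) : ((-1 : ℂ) ^ k) * (-1) ^ k = 1 := by rw [← mul_zpow]; simp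
  linear_combination (q ^ choose2 m * q ^ choose2 r * a ^ m * b ^ r) *
    ((-1 : ℂ) ^ m * (-1 : ℂ) ^ m * e r + e m)

theorem tsum_theta_mul_theta_comm (q a b : ℂ) (N : ℤ) :
    ∑' r : ℤ, q ^ (choose2 (N - r) + choose2 r) * a ^ (N - r) * b ^ r
      = ∑' r : ℤ, q ^ (choose2 (N - r) + choose2 r) * b ^ (N - r) * a ^ r := by
  rw [← (Equiv.subLeft N).tsum_eq]
  refine tsum_congr fun r => ?_
  simp only [Equiv.subLeft_apply, sub_sub_cancel]
  rw [add_comm (choose2 r)]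
  ring

/-- With v = q^(r-1), this is b/(1 - vb) + 1/v = 1/(v(1 - vb)) term by term. The inhomogeneous part
is symmetric in a and b (`tsum_theta_mul_theta_comm`), so it cancels when the roles of a and b are
exchanged and subtracted. -/
theorem crossCoeff_add_one {q a b : ℂ} (hq0 : q ≠ 0) (hq1 : ‖q‖ < 1) (ha : a ≠ 0)
    (hb : b ≠ 0) (hb' : ∀ r : ℤ, b ≠ q ^ r) (N : ℤ) :
    crossCoeff q a b (N + 1) = q ^ (N - 1) * (a * b) * (crossCoeff q a b N +
      ∑' r : ℤ, q ^ (choose2 (N - 1 - r) + choose2 r) * a ^ (N - 1 - r) * b ^ r) := by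
  have h1 := summable_crossCoeff_term hq0 hq1 ha hb N
  have h2 := summable_theta_mul_theta hq0 hq1 ha hb (N - 1)
  rw [← (Equiv.subRight (1 : ℤ)).summable_iff] at h2
  rw [← (Equiv.subRight (1 : ℤ)).tsum_eq, crossCoeff, crossCoeff]
  have h3 := h1.tsum_add h2
  simp only [Function.comp] at h3
  rw [← h3, ← tsum_mul_left]
  refine tsum_congr fun r => ?_
  simp only [Equiv.subRight_apply]
  have hr := one_sub_zpow_mul_ne_zero hb' (r - 1)
  rw [show N + 1 - r = N - r + 1 by ring, show N - 1 - (r - 1) = N - r by ring,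
    choose2_add_one, choose2_sub_one, zpow_add_one₀ ha, zpow_sub_one₀ hb]
  obtain ⟨m, rfl⟩ : ∃ m, N = m + r := ⟨N - r, by ring⟩
  rw [add_sub_cancel_right, show m + r - 1 = m + (r - 1) by ring,
    show choose2 m + (choose2 r - r + 1) = choose2 m + choose2 r - (r - 1) by ring,
    show choose2 m + m + choose2 r = choose2 m + choose2 r + m by ring]
  simp only [zpow_sub₀ hq0 _ (r - 1), zpow_add₀ hq0 _ m, zpow_add₀ hq0 m]
  have hq := zpow_ne_zero (r - 1) hq0
  generalize q ^ (r - 1) = v at *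
  field_simp
  ring

theorem crossCoeff_sub_eq {q a b : ℂ} (hq0 : q ≠ 0) (hq1 : ‖q‖ < 1) (ha : a ≠ 0) (hb : b ≠ 0)
    (ha' : ∀ r : ℤ, a ≠ q ^ r) (hb' : ∀ r : ℤ, b ≠ q ^ r) (N : ℤ) :
    crossCoeff q a b (N + 1) - crossCoeff q b a (N + 1)
      = q ^ choose2 N * (a * b) ^ N * (crossCoeff q a b 1 - crossCoeff q b a 1) := by
  have hab := mul_ne_zero ha hb
  have step (N : ℤ) : crossCoeff q a b (N + 1) - crossCoeff q b a (N + 1)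
      = q ^ (N - 1) * (a * b) * (crossCoeff q a b N - crossCoeff q b a N) := by
    rw [crossCoeff_add_one hq0 hq1 ha hb hb', crossCoeff_add_one hq0 hq1 hb ha ha',
      tsum_theta_mul_theta_comm q a b]
    ring
  induction N using Int.induction_on with
  | zero => simp [choose2_zero]
  | succ n ih =>
    rw [step, ih, choose2_add_one, zpow_add₀ hq0, zpow_add_one₀ hab, add_sub_cancel_right]
    ring
  | pred n ih =>
    rw [step] at ih
    rw [sub_add_cancel, choose2_sub_one, zpow_sub_one₀ hab,
      show choose2 (-n : ℤ) - -n + 1 = choose2 (-n) - (-n - 1) by ring, zpow_sub₀ hq0]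
    have hq := zpow_ne_zero (-(n : ℤ) - 1) hq0
    field_simp
    linear_combination ih

/-- The homogeneous recurrence in `crossCoeff_sub_eq` is the one satisfied by the coefficients of a
theta series in aby, so only a scalar independent of y is left undetermined. -/
theorem exists_jTheta_mul_lerchSum_sub {q a b : ℂ} (hq0 : q ≠ 0) (hq1 : ‖q‖ < 1) (ha : a ≠ 0)
    (hb : b ≠ 0) (ha' : ∀ r : ℤ, a ≠ q ^ r) (hb' : ∀ r : ℤ, b ≠ q ^ r) :
    ∃ C, ∀ y, y ≠ 0 → jTheta (a * y) q * lerchSum q b (b * y)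
      - jTheta (b * y) q * lerchSum q a (a * y) = C * y * jTheta (a * b * y) q := by
  refine ⟨-(crossCoeff q a b 1 - crossCoeff q b a 1), fun y hy => ?_⟩
  have h := (hasSum_crossCoeff hq0 hq1 ha hb hy).sub (hasSum_crossCoeff hq0 hq1 hb ha hy)
  rw [← (Equiv.addRight (1 : ℤ)).hasSum_iff] at h
  refine h.unique ?_
  have h2 := (hasSum_jTheta hq0 hq1 (mul_ne_zero (mul_ne_zero ha hb) hy)).mul_left
    (-(crossCoeff q a b 1 - crossCoeff q b a 1) * y)
  convert! h2 using 2 with N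
  simp only [Function.comp, Equiv.coe_addRight]
  rw [← mul_sub, crossCoeff_sub_eq hq0 hq1 ha hb ha' hb', zpow_add_one₀ hy,
    zpow_add_one₀ (by norm_num), mul_zpow _ y]
  ring

theorem jTheta_mul_lerchSum_one_eq {q a b : ℂ} (hq0 : q ≠ 0) (hq1 : ‖q‖ < 1) (ha : a ≠ 0)
    (hb : b ≠ 0) (ha' : ∀ r : ℤ, a ≠ q ^ r) (hb' : ∀ r : ℤ, b ≠ q ^ r)
    (hab : jTheta (b / a) q ≠ 0) :
    jTheta a q * lerchSum q a 1 = jTheta b q * lerchSum q b 1 := by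
  obtain ⟨C, hC⟩ := exists_jTheta_mul_lerchSum_sub hq0 hq1 ha hb ha' hb'
  -- At y = 1/a and y = 1/b one of the two products vanishes because j(1) = 0; eliminating C from
  -- the two equations gives the symmetry.
  have h1 := hC a⁻¹ (inv_ne_zero ha)
  have h2 := hC b⁻¹ (inv_ne_zero hb)
  have e := jTheta_inv hq0 hq1 (div_ne_zero hb ha)
  rw [inv_div] at e
  rw [mul_inv_cancel₀ ha, jTheta_one, mul_right_comm a b, mul_inv_cancel₀ ha, one_mul,
    ← div_eq_mul_inv b] at h1
  rw [mul_inv_cancel₀ hb, jTheta_one, mul_inv_cancel_right₀ hb, ← div_eq_mul_inv a, e] at h2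
  apply mul_left_cancel₀ (mul_ne_zero ha hab)
  field_simp at h1 h2
  linear_combination (-jTheta a q) * h1 + (jTheta b q) * h2

/-- On the unit circle |q^s u| = |q|^s, so for s ≠ 0 the denominator stays away from 0 uniformly in
u. This uniformity is the reason for approaching 1 along the circle. -/
theorem norm_one_sub_div_le {q u : ℂ} (hq0 : q ≠ 0) (hq1 : ‖q‖ < 1) (hu : ‖u‖ = 1) (s : ℤ) :
    ‖(1 - u) / (1 - q ^ s * u)‖ ≤ 2 / (1 - ‖q‖) := by
  have hρ : 0 < ‖q‖ := norm_pos_iff.2 hq0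
  have hρ' : 0 < 1 - ‖q‖ := by linarith
  have hn : ‖q ^ s * u‖ = ‖q‖ ^ s := by simp [hu]
  rcases lt_trichotomy s 0 with hs | rfl | hs
  · have h1 : ‖q‖ ^ (-1 : ℤ) ≤ ‖q‖ ^ s := zpow_le_zpow_right_of_le_one₀ hρ hq1.le (by omega)
    have h2 := norm_sub_norm_le (q ^ s * u) 1
    rw [hn, norm_one, norm_sub_rev] at h2
    -- Equivalent to (1 - |q|)² ≥ 0; it yields |q|^s - 1 ≥ 1 - |q| for negative s.
    have h3 : 2 - ‖q‖ ≤ ‖q‖ ^ (-1 : ℤ) := by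
      rw [zpow_neg_one, ← one_div, le_div_iff₀ hρ]
      nlinarith [sq_nonneg (‖q‖ - 1)]
    rw [norm_div]
    gcongr
    · exact (norm_sub_le _ _).trans (by rw [hu, norm_one]; norm_num)
    · linarith
  · rw [zpow_zero, one_mul]
    refine (?_ : _ ≤ (1 : ℝ)).trans ?_
    · rw [norm_div]; exact div_self_le_one _
    · rw [le_div_iff₀ hρ']; linarith
  · have h1 : ‖q‖ ^ s ≤ ‖q‖ ^ (1 : ℤ) := zpow_le_zpow_right_of_le_one₀ hρ hq1.le (by omega)
    have h2 := norm_sub_norm_le 1 (q ^ s * u)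
    rw [hn, norm_one] at h2
    rw [zpow_one] at h1
    rw [norm_div]
    gcongr
    · exact (norm_sub_le _ _).trans (by rw [hu, norm_one]; norm_num)
    · linarith

theorem eventually_exp_mul_I_ne_one :
    ∀ᶠ θ : ℝ in 𝓝[≠] 0, Complex.exp (θ * Complex.I) ≠ 1 := by
  have h : HasDerivAt (fun θ : ℝ => Complex.exp (θ * Complex.I))
      (Complex.exp ((0 : ℝ) * Complex.I) * (1 * Complex.I)) 0 :=
    ((Complex.ofRealCLM.hasDerivAt (x := 0)).mul_const Complex.I).cexp
  exact h.eventually_ne (by simp)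

theorem tendsto_exp_mul_I :
    Tendsto (fun θ : ℝ => Complex.exp (θ * Complex.I)) (𝓝[≠] 0) (𝓝 1) := by
  have h : Continuous fun θ : ℝ => Complex.exp (θ * Complex.I) := by fun_prop
  have := h.tendsto 0
  simp only [Complex.ofReal_zero, zero_mul, Complex.exp_zero] at this
  exact this.mono_left nhdsWithin_le_nhds

/-- Only the term r = 1 has a pole at u = 1, and its numerator is -1; every other term is killed by
1 - u. -/
theorem tendsto_one_sub_mul_lerchSum {q : ℂ} (hq0 : q ≠ 0) (hq1 : ‖q‖ < 1) :
    Tendsto (fun θ : ℝ => (1 - Complex.exp (θ * Complex.I))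
      * lerchSum q (Complex.exp (θ * Complex.I)) 1) (𝓝[≠] 0) (𝓝 (-1)) := by
  have key := tendsto_tsum_of_dominated_convergence (𝓕 := 𝓝[≠] (0 : ℝ))
    (f := fun (θ : ℝ) (r : ℤ) => (-1 : ℂ) ^ r * q ^ choose2 r * 1 ^ r *
      ((1 - Complex.exp (θ * Complex.I)) / (1 - q ^ (r - 1) * Complex.exp (θ * Complex.I))))
    (g := fun r : ℤ => if r = 1 then -1 else 0)
    ((summable_norm_theta hq0 hq1 one_ne_zero).mul_right (2 / (1 - ‖q‖)))
    (fun r => ?_) (Eventually.of_forall fun θ r => ?_)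
  · rw [tsum_ite_eq] at key
    refine key.congr fun θ => ?_
    rw [lerchSum, ← tsum_mul_left]
    exact tsum_congr fun r => by ring
  · split_ifs with h
    · subst h
      refine tendsto_const_nhds.congr' ?_
      filter_upwards [eventually_exp_mul_I_ne_one] with θ hθ
      simp [choose2_one, div_self (sub_ne_zero.2 hθ.symm)]
    · have h1 : (1 : ℂ) - q ^ (r - 1) * 1 ≠ 0 := by
        intro h0
        have h2 : ‖q‖ ^ (r - 1) = 1 := by
          rw [← norm_zpow, ← mul_one (q ^ (r - 1)), ← sub_eq_zero.1 h0, norm_one]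
        rw [zpow_eq_one_iff_right₀ (norm_nonneg _) hq1.ne] at h2
        omega
      have h2 := ((tendsto_exp_mul_I.const_sub 1).div
        ((tendsto_exp_mul_I.const_mul (q ^ (r - 1))).const_sub 1) h1).const_mul
          ((-1 : ℂ) ^ r * q ^ choose2 r * 1 ^ r)
      simpa using h2
  · rw [norm_mul]
    exact mul_le_mul_of_nonneg_left
      (norm_one_sub_div_le hq0 hq1 (Complex.norm_exp_ofReal_mul_I θ) _) (norm_nonneg _)

theorem tendsto_jTheta_mul_lerchSum_one {q : ℂ} (hq0 : q ≠ 0) (hq1 : ‖q‖ < 1) :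
    Tendsto (fun θ : ℝ => jTheta (Complex.exp (θ * Complex.I)) q
      * lerchSum q (Complex.exp (θ * Complex.I)) 1) (𝓝[≠] 0) (𝓝 (-qPoch q q ^ 3)) := by
  have hc := continuous_qPoch hq1
  have h1 : Tendsto (fun u : ℂ => qPoch (u * q) q * qPoch (q / u) q * qPoch q q) (𝓝 1)
      (𝓝 (qPoch (1 * q) q * qPoch (q / 1) q * qPoch q q)) :=
    (((hc.tendsto _).comp (tendsto_id.mul_const q)).mul
      ((hc.tendsto _).comp (tendsto_const_nhds.div tendsto_id one_ne_zero))).mul_const _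
  have h2 := (h1.comp tendsto_exp_mul_I).mul (tendsto_one_sub_mul_lerchSum hq0 hq1)
  rw [one_mul, div_one] at h2
  convert! h2 using 2 with θ
  · simp only [Function.comp]
    rw [jTheta, qPoch_eq_mul hq1 (Complex.exp _)]
    ring
  · ring

/-- By `jTheta_mul_lerchSum_one_eq` the product may be evaluated at a nearby-to-1 point of the unit
circle instead of a; there the simple zero of j cancels the simple pole of the Lerch sum. -/
theorem jTheta_mul_lerchSum_one {q a : ℂ} (hq0 : q ≠ 0) (hq1 : ‖q‖ < 1) (ha : a ≠ 0)
    (ha' : ∀ r : ℤ, a ≠ q ^ r) :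
    jTheta a q * lerchSum q a 1 = -qPoch q q ^ 3 := by
  refine tendsto_nhds_unique (tendsto_const_nhds.congr' ?_)
    (tendsto_jTheta_mul_lerchSum_one hq0 hq1)
  have h0 : jTheta (1 / a) q ≠ 0 := by
    rw [one_div, jTheta_inv hq0 hq1 ha]
    exact mul_ne_zero (by simpa) (jTheta_ne_zero hq0 hq1 ha ha')
  have h1 : Tendsto (fun θ : ℝ => jTheta (Complex.exp (θ * Complex.I) / a) q) (𝓝[≠] 0)
      (𝓝 (jTheta (1 / a) q)) :=
    (continuousAt_jTheta hq1 (one_div_ne_zero ha)).tendsto.comp (tendsto_exp_mul_I.div_const a)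
  filter_upwards [eventually_exp_mul_I_ne_one, h1.eventually_ne h0] with θ hθ hθ'
  refine jTheta_mul_lerchSum_one_eq hq0 hq1 ha (Complex.exp_ne_zero _) ha' (fun r hr => ?_) hθ'
  have h2 : ‖q‖ ^ r = 1 := by
    rw [← norm_zpow, ← hr, Complex.norm_exp_ofReal_mul_I]
  rw [zpow_eq_one_iff_right₀ (norm_nonneg _) hq1.ne] at h2
  rw [h2, zpow_zero] at hr
  exact hθ hr

/-- The change of the elliptic parameter in an Appell--Lerch series. -/
theorem jTheta_mul_lerchSum_sub {q a b y : ℂ} (hq0 : q ≠ 0) (hq1 : ‖q‖ < 1) (ha : a ≠ 0)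
    (hb : b ≠ 0) (hy : y ≠ 0) (ha' : ∀ r : ℤ, a ≠ q ^ r) (hb' : ∀ r : ℤ, b ≠ q ^ r) :
    jTheta (a * y) q * lerchSum q b (b * y) - jTheta (b * y) q * lerchSum q a (a * y)
      = a * y * qPoch q q ^ 3 * jTheta (b / a) q * jTheta (a * b * y) q
        / (jTheta a q * jTheta b q) := by
  obtain ⟨C, hC⟩ := exists_jTheta_mul_lerchSum_sub hq0 hq1 ha hb ha' hb'
  rw [hC y hy]
  have h1 := hC a⁻¹ (inv_ne_zero ha)
  rw [mul_inv_cancel₀ ha, jTheta_one, mul_right_comm a b, mul_inv_cancel₀ ha, one_mul,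
    ← div_eq_mul_inv b] at h1
  have h2 := jTheta_mul_lerchSum_one hq0 hq1 ha ha'
  have ja := jTheta_ne_zero hq0 hq1 ha ha'
  have jb := jTheta_ne_zero hq0 hq1 hb hb'
  generalize jTheta (a * b * y) q = T
  field_simp at h1 ⊢
  linear_combination (-T * jTheta a q) * h1 + (-T * a * jTheta (b / a) q) * h2

/-! ### Dissection of Appell--Lerch series -/

theorem tsum_int_eq_sum_residues {f : ℤ → ℂ} (hf : Summable f) {n : ℕ} (hn : n ≠ 0) :
    ∑' r, f r = ∑ t ∈ Finset.range n, ∑' s : ℤ, f (n * s + t + 1) := by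
  have : NeZero n := ⟨hn⟩
  -- The shift by 1 makes r - 1, not r, equal to n s + t, because the denominators involve q^(r-1).
  let e : ℤ × Fin n ≃ ℤ := (Int.divModEquiv n).symm.trans (Equiv.addRight 1)
  have he (p : ℤ × Fin n) : e p = n * p.1 + (p.2 : ℕ) + 1 := by
    simp only [e, Equiv.trans_apply, Int.divModEquiv_symm_apply, Equiv.coe_addRight]
    ring
  have h1 := e.summable_iff.2 hf
  rw [← e.tsum_eq, ← (Equiv.prodComm (Fin n) ℤ).tsum_eq]
  have h2 := (Equiv.prodComm (Fin n) ℤ).summable_iff.2 h1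
  simp only [Function.comp_def] at h2
  rw [h2.tsum_prod, tsum_fintype, Finset.sum_range]
  refine Finset.sum_congr rfl fun t _ => tsum_congr fun s => ?_
  simp [he]

theorem theta_term_residue {q z : ℂ} (hq0 : q ≠ 0) (hz : z ≠ 0) (n t : ℕ) (k s : ℤ) :
    (-1 : ℂ) ^ (n * s + t + 1) * q ^ choose2 (n * s + t + 1) * z ^ (n * s + t + 1)
        * q ^ (k * (n * s + t))
      = -(z * q ^ (choose2 (t + 1) + k * t) * (-z) ^ t) * ((-1) ^ s * (q ^ n ^ 2) ^ choose2 s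
        * (-(q ^ (choose2 (n + 1) + n * k + n * t) * (-z) ^ n)) ^ s) := by
  have hm : (-1 : ℂ) ≠ 0 := by norm_num
  have e : ((-1 : ℂ) ^ s) * (-1) ^ s = 1 := by rw [← mul_zpow]; simp
  have hc : choose2 (n * s + t + 1)
      = n ^ 2 * choose2 s + s * (choose2 (n + 1) + n * t) + choose2 (t + 1) := by
    refine choose2_eq_of ?_
    linear_combination (-(n : ℤ) ^ 2) * two_mul_choose2 s - s * two_mul_choose2 (n + 1)
      - two_mul_choose2 (t + 1)
  have hx : choose2 (n * s + t + 1) + k * (n * s + t) = (choose2 (t + 1) + k * t)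
      + n ^ 2 * choose2 s + (choose2 (n + 1) + n * k + n * t) * s := by
    rw [hc]; ring
  have h1 : q ^ choose2 (n * s + t + 1) * q ^ (k * (n * s + t))
      = q ^ (choose2 (t + 1) + k * t) * (q ^ n ^ 2) ^ choose2 s
        * (q ^ (choose2 (n + 1) + n * k + n * t)) ^ s := by
    rw [← zpow_add₀ hq0, hx, zpow_add₀ hq0, zpow_add₀ hq0, ← zpow_natCast q (n ^ 2), ← zpow_mul,
      ← zpow_mul]
    push_cast
    rfl
  have h2 : (-(q ^ (choose2 (n + 1) + n * k + n * t) * (-z) ^ n)) ^ s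
      = (-1) ^ s * (q ^ (choose2 (n + 1) + n * k + n * t)) ^ s
        * ((-1) ^ (n * s) * z ^ (n * s)) := by
    rw [neg_eq_neg_one_mul, mul_zpow, mul_zpow, ← zpow_natCast (-z) n, ← zpow_mul (-z),
      neg_eq_neg_one_mul z, mul_zpow, mul_assoc]
  have h3 : (-z) ^ t = (-1) ^ (t : ℤ) * z ^ (t : ℤ) := by
    rw [neg_eq_neg_one_mul, mul_pow, zpow_natCast, zpow_natCast]
  rw [h2, h3, zpow_add_one₀ hm, zpow_add₀ hm, zpow_add_one₀ hz, zpow_add₀ hz]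
  linear_combination ((-1) ^ (n * s) * (-1) ^ (t : ℤ) * -1 * (z ^ (n * s) * z ^ (t : ℤ) * z)) * h1
    + (z * q ^ (choose2 (t + 1) + k * t) * ((-1) ^ (t : ℤ) * z ^ (t : ℤ)) * (q ^ n ^ 2) ^ choose2 s
      * (q ^ (choose2 (n + 1) + n * k + n * t)) ^ s * ((-1) ^ (n * s) * z ^ (n * s))) * e

theorem summable_theta_mul_zpow {q z : ℂ} (hq0 : q ≠ 0) (hq1 : ‖q‖ < 1) (hz : z ≠ 0) (k : ℤ) :
    Summable fun r : ℤ => ‖(-1 : ℂ) ^ r * q ^ choose2 r * z ^ r * q ^ (k * (r - 1))‖ := by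
  refine ((summable_norm_theta hq0 hq1 (mul_ne_zero hz (zpow_ne_zero k hq0))).mul_right
    ‖q ^ (-k)‖).congr fun r => ?_
  rw [← norm_mul]
  congr 1
  rw [mul_zpow, ← zpow_mul, mul_sub, mul_one, sub_eq_add_neg, zpow_add₀ hq0]
  ring

/-- Dissection of a theta function into `n` theta functions of nome `q ^ n ^ 2`. -/
theorem sum_jTheta_eq {q z : ℂ} (hq0 : q ≠ 0) (hq1 : ‖q‖ < 1) (hz : z ≠ 0) {n : ℕ} (hn : n ≠ 0)
    (k : ℤ) :
    ∑ t ∈ Finset.range n, -(z * q ^ (choose2 (t + 1) + k * t) * (-z) ^ t)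
        * jTheta (-(q ^ (choose2 (n + 1) + n * k + n * t) * (-z) ^ n)) (q ^ n ^ 2)
      = (-1) ^ k * z ^ (-k) * q ^ (-choose2 (k + 1)) * jTheta z q := by
  have hQ0 : q ^ n ^ 2 ≠ 0 := pow_ne_zero _ hq0
  have hQ1 : ‖q ^ n ^ 2‖ < 1 := by
    rw [norm_pow]; exact pow_lt_one₀ (norm_nonneg _) hq1 (by positivity)
  have h1 : ∑' r : ℤ, (-1 : ℂ) ^ r * q ^ choose2 r * z ^ r * q ^ (k * (r - 1))
      = q ^ (-k) * jTheta (q ^ k * z) q := by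
    rw [jTheta_eq_tsum hq0 hq1 (mul_ne_zero (zpow_ne_zero k hq0) hz), ← tsum_mul_left]
    refine tsum_congr fun r => ?_
    rw [mul_zpow, ← zpow_mul, mul_sub, mul_one, sub_eq_add_neg, zpow_add₀ hq0]
    ring
  rw [jTheta_zpow_mul hq0 hq1 hz] at h1
  rw [choose2_add_one k, neg_add, zpow_add₀ hq0]
  trans ∑' r : ℤ, (-1 : ℂ) ^ r * q ^ choose2 r * z ^ r * q ^ (k * (r - 1))
  · rw [tsum_int_eq_sum_residues (summable_theta_mul_zpow hq0 hq1 hz k).of_norm hn]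
    refine Finset.sum_congr rfl fun t _ => ?_
    rw [jTheta_eq_tsum hQ0 hQ1 (neg_ne_zero.2 (mul_ne_zero (zpow_ne_zero _ hq0)
      (pow_ne_zero _ (neg_ne_zero.2 hz)))), ← tsum_mul_left]
    refine tsum_congr fun s => ?_
    rw [← theta_term_residue hq0 hz, add_sub_cancel_right]
  · rw [h1]; ring

/-- Dissection of a bilateral series into `n` series of Appell--Lerch type of nome `q ^ n ^ 2`. -/
theorem tsum_eq_sum_lerchSum {q x z : ℂ} (hq0 : q ≠ 0) (hq1 : ‖q‖ < 1) (hx : x ≠ 0) (hz : z ≠ 0)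
    {n : ℕ} (hn : n ≠ 0) (k : ℤ) :
    ∑' r : ℤ, (-1 : ℂ) ^ r * q ^ choose2 r * z ^ r * (q ^ (r - 1) * (x * z)) ^ k
        / (1 - (q ^ (r - 1) * (x * z)) ^ n)
      = ∑ t ∈ Finset.range n, -(x ^ k * z ^ (k + 1) * q ^ (choose2 (t + 1) + k * t) * (-z) ^ t)
        * lerchSum (q ^ n ^ 2) (q ^ n ^ 2 * (q ^ (n * t) * (x * z) ^ n))
          (-(q ^ (choose2 (n + 1) + n * k + n * t) * (-z) ^ n)) := by
  have hQ0 : q ^ n ^ 2 ≠ 0 := pow_ne_zero _ hq0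
  have hpow (r : ℤ) : (q ^ (r - 1) * (x * z)) ^ n = (q ^ n) ^ (r - 1) * (x * z) ^ n := by
    rw [mul_pow, ← zpow_natCast (q ^ (r - 1)), ← zpow_natCast q n, ← zpow_mul, ← zpow_mul,
      mul_comm (r - 1)]
  have hfac (r : ℤ) : (-1 : ℂ) ^ r * q ^ choose2 r * z ^ r * (q ^ (r - 1) * (x * z)) ^ k
        / (1 - (q ^ (r - 1) * (x * z)) ^ n)
      = (x * z) ^ k * ((-1 : ℂ) ^ r * q ^ choose2 r * z ^ r * q ^ (k * (r - 1)))
        * (1 - (q ^ n) ^ (r - 1) * (x * z) ^ n)⁻¹ := by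
    rw [hpow, mul_zpow (q ^ (r - 1)), ← zpow_mul, mul_comm (r - 1) k]
    ring
  have hs : Summable fun r : ℤ => (-1 : ℂ) ^ r * q ^ choose2 r * z ^ r
      * (q ^ (r - 1) * (x * z)) ^ k / (1 - (q ^ (r - 1) * (x * z)) ^ n) := by
    have hqn : ‖q ^ n‖ < 1 := by
      rw [norm_pow]; exact pow_lt_one₀ (norm_nonneg _) hq1 hn
    obtain ⟨B, hB, h⟩ := exists_norm_inv_le (pow_ne_zero n hq0) hqn
      (pow_ne_zero n (mul_ne_zero hx hz))
    refine Summable.of_norm_bounded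
      (((summable_theta_mul_zpow hq0 hq1 hz k).mul_left ‖(x * z) ^ k‖).mul_right B) fun r => ?_
    rw [hfac, norm_mul, norm_mul]
    exact mul_le_mul_of_nonneg_left (h _) (by positivity)
  rw [tsum_int_eq_sum_residues hs hn]
  refine Finset.sum_congr rfl fun t _ => ?_
  rw [lerchSum, ← tsum_mul_left]
  refine tsum_congr fun s => ?_
  have h := theta_term_residue hq0 hz n t k s
  rw [hfac, add_sub_cancel_right, h, mul_zpow, zpow_add_one₀ hz]
  have e : (q ^ n) ^ ((n : ℤ) * s + t) * (x * z) ^ n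
      = (q ^ n ^ 2) ^ (s - 1) * (q ^ n ^ 2 * (q ^ (n * t) * (x * z) ^ n)) := by
    rw [zpow_sub_one₀ hQ0, zpow_add₀ (pow_ne_zero n hq0), zpow_mul, zpow_natCast, zpow_natCast,
      ← pow_mul, ← pow_mul, ← sq]
    field_simp
  rw [e]
  ring

/-- The target m(X, Q, w) does not involve c or Y, so pieces sharing the same X = Qc/Y share one
Appell–Lerch series. -/
theorem lerchSum_eq_appellLerch_add {Q X c Y w : ℂ} (hQ0 : Q ≠ 0) (hQ1 : ‖Q‖ < 1) (hX : X ≠ 0)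
    (hc : c ≠ 0) (hw : w ≠ 0) (hXY : X * Y = Q * c) (hw' : ∀ r : ℤ, w ≠ Q ^ r)
    (hXw : ∀ r : ℤ, X * w ≠ Q ^ r) (hc' : ∀ r : ℤ, c ≠ Q ^ r) :
    lerchSum Q (Q * c) Y = jTheta Y Q * appellLerch X Q w
      + qPoch Q Q ^ 3 * (jTheta (Y / w) Q * jTheta (c * w) Q)
        / (jTheta w Q * (jTheta (X * w) Q * jTheta c Q)) := by
  have hXw0 := mul_ne_zero hX hw
  have hQc' : ∀ r : ℤ, Q * c ≠ Q ^ r := fun r hr => hc' (r - 1) (by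
    rw [zpow_sub_one₀ hQ0, ← hr]; field_simp)
  -- Here a = Xw, b = Qc and y = 1/X, chosen so that ay = w and by = Y.
  have h := jTheta_mul_lerchSum_sub (y := X⁻¹) hQ0 hQ1 hXw0 (mul_ne_zero hQ0 hc)
    (inv_ne_zero hX) hXw hQc'
  have e1 : X * w * X⁻¹ = w := by field_simp
  have e2 : Q * c * X⁻¹ = Y := by rw [← hXY]; field_simp
  have e3 : Q * c / (X * w) = Y / w := by rw [← hXY]; field_simp
  have e4 : X * w * (Q * c) * X⁻¹ = Q * (c * w) := by field_simp
  rw [e1, e2, e3, e4, jTheta_mul_self hQ0 hQ1 hc, jTheta_mul_self hQ0 hQ1 (mul_ne_zero hc hw)]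
    at h
  have j1 := jTheta_ne_zero hQ0 hQ1 hw hw'
  have j2 := jTheta_ne_zero hQ0 hQ1 hXw0 hXw
  have j3 := jTheta_ne_zero hQ0 hQ1 hc hc'
  rw [appellLerch_eq_lerchSum]
  field_simp at h ⊢
  linear_combination h

/-- The sum of a series with denominators `1 - v ^ n` in terms of one Appell--Lerch series of nome
`q ^ n ^ 2` and the theta quotients `Psi`. -/
theorem tsum_eq_appellLerch_add_Psi {q x z w : ℂ} (hq0 : q ≠ 0) (hq1 : ‖q‖ < 1) (hx : x ≠ 0)
    (hz : z ≠ 0) (hz' : ∀ r : ℤ, z ≠ q ^ r) {n : ℕ} (hn : n ≠ 0) (k : ℤ)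
    (hw : Generic (-(q ^ (choose2 n - n * k) * (-x) ^ n)) (q ^ n ^ 2) w)
    (hc : ∀ t < n, ∀ r : ℤ, q ^ (n * t) * (x * z) ^ n ≠ (q ^ n ^ 2) ^ r) :
    ∑' r : ℤ, (-1 : ℂ) ^ r * q ^ choose2 r * z ^ r * (q ^ (r - 1) * (x * z)) ^ k
        / (1 - (q ^ (r - 1) * (x * z)) ^ n)
      = jTheta z q * (q ^ (-choose2 (k + 1)) * (-x) ^ k
          * appellLerch (-(q ^ (choose2 n - n * k) * (-x) ^ n)) (q ^ n ^ 2) w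
        + Psi k n x z w q) := by
  have hQ0 : q ^ n ^ 2 ≠ 0 := pow_ne_zero _ hq0
  have hQ1 : ‖q ^ n ^ 2‖ < 1 := by
    rw [norm_pow]; exact pow_lt_one₀ (norm_nonneg _) hq1 (by positivity)
  obtain ⟨hw0, hw1, hw2⟩ := hw
  have hX : -(q ^ (choose2 n - n * k) * (-x) ^ n) ≠ 0 :=
    neg_ne_zero.2 (mul_ne_zero (zpow_ne_zero _ hq0) (pow_ne_zero _ (neg_ne_zero.2 hx)))
  have jz := jTheta_ne_zero hq0 hq1 hz hz'
  -- The decisive point: the first factor is independent of t, so all n residue classes reduce to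
  -- one Appell–Lerch series.
  have hXY (t : ℕ) : -(q ^ (choose2 n - n * k) * (-x) ^ n)
      * -(q ^ (choose2 (n + 1) + n * k + n * t) * (-z) ^ n)
      = q ^ n ^ 2 * (q ^ (n * t) * (x * z) ^ n) := by
    have e1 : q ^ (choose2 n - n * k) * q ^ (choose2 (n + 1) + n * k + n * t)
        = q ^ n ^ 2 * q ^ (n * t) := by
      rw [← zpow_add₀ hq0, ← pow_add, ← zpow_natCast]
      congr 1
      push_cast
      rw [choose2_add_one]
      linear_combination two_mul_choose2 n
    rw [show x * z = (-x) * (-z) by ring, mul_pow]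
    linear_combination ((-x) ^ n * (-z) ^ n) * e1
  rw [tsum_eq_sum_lerchSum hq0 hq1 hx hz hn k]
  have h1 : ∀ t ∈ Finset.range n,
      -(x ^ k * z ^ (k + 1) * q ^ (choose2 (t + 1) + k * t) * (-z) ^ t)
        * lerchSum (q ^ n ^ 2) (q ^ n ^ 2 * (q ^ (n * t) * (x * z) ^ n))
          (-(q ^ (choose2 (n + 1) + n * k + n * t) * (-z) ^ n))
      = x ^ k * z ^ k * appellLerch (-(q ^ (choose2 n - n * k) * (-x) ^ n)) (q ^ n ^ 2) w
          * (-(z * q ^ (choose2 (t + 1) + k * t) * (-z) ^ t)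
            * jTheta (-(q ^ (choose2 (n + 1) + n * k + n * t) * (-z) ^ n)) (q ^ n ^ 2))
        + jTheta z q * (-(x ^ k * z ^ (k + 1) * qPoch (q ^ n ^ 2) (q ^ n ^ 2) ^ 3
            / (jTheta z q * jTheta w (q ^ n ^ 2)))
          * (q ^ (choose2 (t + 1) + k * t) * (-z) ^ t
            * (jTheta (-(q ^ (choose2 (n + 1) + n * k + n * t) * (-z) ^ n / w)) (q ^ n ^ 2)
              * jTheta (q ^ (n * t) * (x * z) ^ n * w) (q ^ n ^ 2))
            / (jTheta (-(q ^ (choose2 n - n * k) * (-x) ^ n * w)) (q ^ n ^ 2)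
              * jTheta (q ^ (n * t) * (x * z) ^ n) (q ^ n ^ 2)))) := by
    intro t ht
    rw [lerchSum_eq_appellLerch_add hQ0 hQ1 hX
      (mul_ne_zero (pow_ne_zero _ hq0) (pow_ne_zero _ (mul_ne_zero hx hz))) hw0 (hXY t) hw1 hw2
      (hc t (Finset.mem_range.1 ht)), neg_mul _ w, neg_div, zpow_add_one₀ hz]
    field_simp
    ring
  rw [Finset.sum_congr rfl h1, Finset.sum_add_distrib, ← Finset.mul_sum, ← Finset.mul_sum,
    ← Finset.mul_sum, sum_jTheta_eq hq0 hq1 hz hn, ← Psi, mul_add, neg_eq_neg_one_mul x, mul_zpow,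
    zpow_neg z]
  have hzk : z ^ k ≠ 0 := zpow_ne_zero _ hz
  congr 1
  field_simp

/-! ### Absolutely convergent power series -/

/-- The power series `f` converges absolutely at `q` to the value `v`, and the sum of the absolute
values of its terms is at most `B`. -/
structure EvalsTo (q : ℂ) (f : PowerSeries ℂ) (v : ℂ) (B : ℝ) : Prop where
  summable : Summable fun n => ‖PowerSeries.coeff n f * q ^ n‖
  norm_le : ∑' n, ‖PowerSeries.coeff n f * q ^ n‖ ≤ B
  eq : ∑' n, PowerSeries.coeff n f * q ^ n = v

namespace EvalsTo

variable {q : ℂ} {f g : PowerSeries ℂ} {v w : ℂ} {B C : ℝ}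

theorem nonneg (h : EvalsTo q f v B) : 0 ≤ B := (tsum_nonneg fun _ => norm_nonneg _).trans h.norm_le

theorem mono (h : EvalsTo q f v B) (hB : B ≤ C) : EvalsTo q f v C :=
  ⟨h.summable, h.norm_le.trans hB, h.eq⟩

theorem monomial (q c : ℂ) (m : ℕ) :
    EvalsTo q (PowerSeries.C c * PowerSeries.X ^ m) (c * q ^ m) (‖c‖ * ‖q‖ ^ m) := by
  have h (n : ℕ) : PowerSeries.coeff n (PowerSeries.C c * PowerSeries.X ^ m) * q ^ n
      = if n = m then c * q ^ m else 0 := by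
    rw [PowerSeries.coeff_C_mul, PowerSeries.coeff_X_pow]
    split_ifs with h <;> simp [h]
  have h' (n : ℕ) : ‖PowerSeries.coeff n (PowerSeries.C c * PowerSeries.X ^ m) * q ^ n‖
      = if n = m then ‖c‖ * ‖q‖ ^ m else 0 := by
    rw [h]; split_ifs <;> simp
  refine ⟨?_, ?_, ?_⟩
  · simp_rw [h']; exact (hasSum_ite_eq m _).summable
  · simp_rw [h']; rw [tsum_ite_eq]
  · simp_rw [h]; rw [tsum_ite_eq]

theorem const (q c : ℂ) : EvalsTo q (PowerSeries.C c) c ‖c‖ := by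
  simpa using monomial q c 0

theorem one (q : ℂ) : EvalsTo q 1 1 1 := by simpa using const q 1

theorem add (hf : EvalsTo q f v B) (hg : EvalsTo q g w C) : EvalsTo q (f + g) (v + w) (B + C) := by
  have hs := hf.summable.add hg.summable
  have hle (n : ℕ) : ‖PowerSeries.coeff n (f + g) * q ^ n‖
      ≤ ‖PowerSeries.coeff n f * q ^ n‖ + ‖PowerSeries.coeff n g * q ^ n‖ := by
    rw [map_add, add_mul]; exact norm_add_le _ _
  have hs' := hs.of_nonneg_of_le (fun _ => norm_nonneg _) hle
  refine ⟨hs', ?_, ?_⟩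
  · refine (hs'.tsum_le_tsum hle hs).trans ?_
    rw [hf.summable.tsum_add hg.summable]
    exact add_le_add hf.norm_le hg.norm_le
  · simp_rw [map_add, add_mul]
    rw [hf.summable.of_norm.tsum_add hg.summable.of_norm, hf.eq, hg.eq]

theorem mul (hf : EvalsTo q f v B) (hg : EvalsTo q g w C) : EvalsTo q (f * g) (v * w) (B * C) := by
  have h (n : ℕ) : PowerSeries.coeff n (f * g) * q ^ n
      = ∑ p ∈ Finset.HasAntidiagonal.antidiagonal n, (PowerSeries.coeff p.1 f * q ^ p.1)
        * (PowerSeries.coeff p.2 g * q ^ p.2) := by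
    rw [PowerSeries.coeff_mul, Finset.sum_mul]
    refine Finset.sum_congr rfl fun p hp => ?_
    rw [← Finset.HasAntidiagonal.mem_antidiagonal.1 hp, pow_add]
    ring
  have hs := summable_norm_sum_mul_antidiagonal_of_summable_norm hf.summable hg.summable
  refine ⟨?_, ?_, ?_⟩
  · simpa only [h] using hs
  · have h2 := summable_norm_sum_mul_antidiagonal_of_summable_norm
      (f := fun n => ‖PowerSeries.coeff n f * q ^ n‖) (g := fun n => ‖PowerSeries.coeff n g * q ^ n‖)
      (by simpa using hf.summable) (by simpa using hg.summable)
    have h3 := tsum_mul_tsum_eq_tsum_sum_antidiagonal_of_summable_norm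
      (f := fun n => ‖PowerSeries.coeff n f * q ^ n‖) (g := fun n => ‖PowerSeries.coeff n g * q ^ n‖)
      (by simpa using hf.summable) (by simpa using hg.summable)
    simp_rw [h]
    refine (hs.tsum_le_tsum (fun n => ?_) h2.of_norm).trans (h3.symm.le.trans ?_)
    · refine (norm_sum_le _ _).trans (Finset.sum_le_sum fun p _ => ?_)
      rw [norm_mul]
    · exact mul_le_mul hf.norm_le hg.norm_le (tsum_nonneg fun _ => norm_nonneg _) hf.nonneg
  · simp_rw [h]
    rw [← tsum_mul_tsum_eq_tsum_sum_antidiagonal_of_summable_norm hf.summable hg.summable, hf.eq,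
      hg.eq]

theorem sum {ι : Type*} (s : Finset ι) {F : ι → PowerSeries ℂ} {V : ι → ℂ} {D : ι → ℝ}
    (h : ∀ i ∈ s, EvalsTo q (F i) (V i) (D i)) :
    EvalsTo q (∑ i ∈ s, F i) (∑ i ∈ s, V i) (∑ i ∈ s, D i) := by
  classical
  induction s using Finset.induction_on with
  | empty => simpa using const q 0
  | insert a s ha ih =>
    rw [Finset.sum_insert ha, Finset.sum_insert ha, Finset.sum_insert ha]
    exact (h a (by simp)).add (ih fun i hi => h i (by simp [hi]))

theorem prod {ι : Type*} (s : Finset ι) {F : ι → PowerSeries ℂ} {V : ι → ℂ} {D : ι → ℝ}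
    (h : ∀ i ∈ s, EvalsTo q (F i) (V i) (D i)) :
    EvalsTo q (∏ i ∈ s, F i) (∏ i ∈ s, V i) (∏ i ∈ s, D i) := by
  classical
  induction s using Finset.induction_on with
  | empty => simpa using one q
  | insert a s ha ih =>
    rw [Finset.prod_insert ha, Finset.prod_insert ha, Finset.prod_insert ha]
    exact (h a (by simp)).mul (ih fun i hi => h i (by simp [hi]))

/-- A power series whose coefficients are eventually those of a sequence of absolutely convergent
power series with summable increments is absolutely convergent, to the limit of the values. -/
theorem tendsto_of_increments {F : ℕ → PowerSeries ℂ} {G : PowerSeries ℂ} {V W : ℕ → ℂ}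
    {D E : ℕ → ℝ} (hc : ∀ n L, n ≤ L → PowerSeries.coeff n (F L) = PowerSeries.coeff n G)
    (hF : ∀ L, EvalsTo q (F L) (V L) (D L))
    (hd : ∀ L, EvalsTo q (F (L + 1) - F L) (W L) (E L)) (hE : Summable E) :
    (Summable fun n => PowerSeries.coeff n G * q ^ n) ∧
      Tendsto V atTop (𝓝 (∑' n, PowerSeries.coeff n G * q ^ n)) := by
  -- Summability of this double array gives, by telescoping from `F 0`, one summable majorant for
  -- all `F L` at once.
  let A : ℕ × ℕ → ℝ := fun p => ‖PowerSeries.coeff p.2 (F (p.1 + 1) - F p.1) * q ^ p.2‖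
  have hA : Summable A := (summable_prod_of_nonneg fun _ => norm_nonneg _).2
    ⟨fun L => (hd L).summable, hE.of_nonneg_of_le (fun L => tsum_nonneg fun _ => norm_nonneg _)
      fun L => (hd L).norm_le⟩
  have hA' := hA.prod_symm
  have hb : Summable fun n => ‖PowerSeries.coeff n (F 0) * q ^ n‖ + ∑' L, A (L, n) :=
    (hF 0).summable.add hA'.prod
  have hle (n L : ℕ) : ‖PowerSeries.coeff n (F L) * q ^ n‖
      ≤ ‖PowerSeries.coeff n (F 0) * q ^ n‖ + ∑' L, A (L, n) := by
    have h1 : PowerSeries.coeff n (F L) * q ^ n = PowerSeries.coeff n (F 0) * q ^ n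
        + ∑ l ∈ Finset.range L, PowerSeries.coeff n (F (l + 1) - F l) * q ^ n := by
      rw [← Finset.sum_mul, ← map_sum, Finset.sum_range_sub F L, map_sub]
      ring
    rw [h1]
    refine (norm_add_le _ _).trans (add_le_add le_rfl ((norm_sum_le _ _).trans ?_))
    exact (hA'.prod_factor n).sum_le_tsum _ fun _ _ => norm_nonneg _
  refine ⟨Summable.of_norm_bounded hb fun n => ?_, ?_⟩
  · rw [← hc n n le_rfl]; exact hle n n
  · have := tendsto_tsum_of_dominated_convergence (𝓕 := atTop)
      (f := fun L n => PowerSeries.coeff n (F L) * q ^ n)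
      (g := fun n => PowerSeries.coeff n G * q ^ n) hb
      (fun n => tendsto_const_nhds.congr' (by
        filter_upwards [eventually_ge_atTop n] with L hL
        rw [hc n L hL]))
      (Eventually.of_forall fun L n => hle n L)
    exact this.congr fun L => (hF L).eq

end EvalsTo

/-! ### Specialization of the rank generating function -/

/-- Evaluation of Laurent polynomials at a unit of `ℂ`. -/
noncomputable def evalAt (u : ℂˣ) : LaurentPolynomial ℤ →+* ℂ :=
  LaurentPolynomial.eval₂ (Int.castRingHom ℂ) u

theorem evalAt_T (u : ℂˣ) (e : ℤ) : evalAt u (LaurentPolynomial.T e) = (u : ℂ) ^ e := by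
  simp [evalAt]

theorem evalAt_apply (u : ℂˣ) (p : LaurentPolynomial ℤ) :
    evalAt u p = ∑ k ∈ p.coeff.support, (p.coeff k : ℂ) * (u : ℂ) ^ k := by
  conv_lhs => rw [← AddMonoidAlgebra.sum_coeff_single p]
  rw [Finsupp.sum, map_sum]
  refine Finset.sum_congr rfl fun k _ => ?_
  rw [LaurentPolynomial.single_eq_C_mul_T]
  simp [evalAt]

/-- Evaluation of the coefficients at a unit of `ℂ`. -/
noncomputable def specialize (u : ℂˣ) : QSeries →+* PowerSeries ℂ := PowerSeries.map (evalAt u)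

theorem specialize_C_T (u : ℂˣ) (e : ℤ) :
    specialize u (PowerSeries.C (LaurentPolynomial.T e)) = PowerSeries.C ((u : ℂ) ^ e) := by
  rw [specialize, PowerSeries.map_C, evalAt_T]

theorem specialize_X (u : ℂˣ) : specialize u PowerSeries.X = PowerSeries.X :=
  PowerSeries.map_X _

theorem specialize_geom_eq (u : ℂˣ) (e : ℤ) {m : ℕ} (hm : m ≠ 0) :
    specialize u (geom e m) = 1 + PowerSeries.X ^ m
      * (PowerSeries.C ((u : ℂ) ^ e) * specialize u (geom e m)) := by
  conv_lhs => rw [geom_eq e hm]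
  rw [map_add, map_one, map_mul, map_mul, map_pow, specialize_X, specialize_C_T]

/-- The recursion g = 1 + u^e X^m g only multiplies earlier coefficients by unimodular numbers. The
resulting majorant ∑ |q|^n does not depend on m. -/
theorem norm_coeff_specialize_geom_le {u : ℂˣ} (hu : ‖(u : ℂ)‖ = 1) (e : ℤ) {m : ℕ} (hm : m ≠ 0)
    (n : ℕ) : ‖PowerSeries.coeff n (specialize u (geom e m))‖ ≤ 1 := by
  induction n using Nat.strong_induction_on with
  | _ n ih =>
    rw [specialize_geom_eq u e hm, map_add, PowerSeries.coeff_X_pow_mul', PowerSeries.coeff_C_mul,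
      PowerSeries.coeff_one]
    split_ifs with h1 h2
    · omega
    · simp
    · simpa [hu] using ih (n - m) (by omega)
    · simp

theorem evalsTo_geom {q : ℂ} (hq1 : ‖q‖ < 1) {u : ℂˣ} (hu : ‖(u : ℂ)‖ = 1) (e : ℤ) {m : ℕ}
    (hm : m ≠ 0) :
    EvalsTo q (specialize u (geom e m)) (1 - (u : ℂ) ^ e * q ^ m)⁻¹ (1 - ‖q‖)⁻¹ := by
  have hg := summable_geometric_of_lt_one (norm_nonneg q) hq1
  have hle (n : ℕ) : ‖PowerSeries.coeff n (specialize u (geom e m)) * q ^ n‖ ≤ ‖q‖ ^ n := by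
    rw [norm_mul, norm_pow]
    exact mul_le_of_le_one_left (by positivity) (norm_coeff_specialize_geom_le hu e hm n)
  have hs := hg.of_nonneg_of_le (fun _ => norm_nonneg _) hle
  have h0 : EvalsTo q (specialize u (geom e m)) _ _ := ⟨hs, le_rfl, rfl⟩
  have h1 := (EvalsTo.one q).add ((EvalsTo.monomial q ((u : ℂ) ^ e) m).mul h0)
  refine ⟨hs, (hs.tsum_le_tsum hle hg).trans (tsum_geometric_of_lt_one (norm_nonneg q) hq1).le, ?_⟩
  have h2 := h1.eq
  rw [mul_assoc, mul_left_comm, ← specialize_geom_eq u e hm] at h2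
  refine eq_inv_of_mul_eq_one_right ?_
  linear_combination h2

/-- Each factor is rewritten as 1 + 2X^k/(1 - X^k), which serves both the convergence estimates and
the overpartition count. -/
theorem specialize_prodTrunc (u : ℂˣ) (L : ℕ) :
    specialize u (prodTrunc L) = ∏ k ∈ Finset.Icc 1 L,
      (1 + PowerSeries.C 2 * PowerSeries.X ^ k * specialize u (geom 0 k)) := by
  rw [prodTrunc, map_prod]
  refine Finset.prod_congr rfl fun k hk => ?_
  have h := specialize_geom_eq u 0 (m := k) (by have := (Finset.mem_Icc.1 hk).1; omega)
  rw [zpow_zero, map_one, one_mul] at h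
  rw [map_mul, map_add, map_one, map_pow, specialize_X, map_ofNat]
  linear_combination h

theorem evalsTo_two_mul_geom {q : ℂ} (hq1 : ‖q‖ < 1) {u : ℂˣ} (hu : ‖(u : ℂ)‖ = 1) {k : ℕ}
    (hk : k ≠ 0) :
    EvalsTo q (PowerSeries.C 2 * PowerSeries.X ^ k * specialize u (geom 0 k))
      (2 * q ^ k * (1 - q ^ k)⁻¹) (2 * ‖q‖ ^ k * (1 - ‖q‖)⁻¹) := by
  simpa using (EvalsTo.monomial q 2 k).mul (evalsTo_geom hq1 hu 0 hk)

theorem exists_evalsTo_prodTrunc {q : ℂ} (hq1 : ‖q‖ < 1) {u : ℂˣ} (hu : ‖(u : ℂ)‖ = 1) :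
    ∃ B, ∀ L, EvalsTo q (specialize u (prodTrunc L))
      (∏ k ∈ Finset.Icc 1 L, (1 + q ^ k) / (1 - q ^ k)) B := by
  have hg := (summable_geometric_of_lt_one (norm_nonneg q) hq1).mul_left 2 |>.mul_right
    (1 - ‖q‖)⁻¹
  have hρ : 0 < 1 - ‖q‖ := by linarith
  -- Obtained from 1 + t ≤ exp t in each factor, hence uniform in L.
  refine ⟨Real.exp (∑' k, 2 * ‖q‖ ^ k * (1 - ‖q‖)⁻¹), fun L => ?_⟩
  rw [specialize_prodTrunc]
  have h := EvalsTo.prod (Finset.Icc 1 L) (fun k hk => (EvalsTo.one q).add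
    (evalsTo_two_mul_geom hq1 hu (k := k) (by have := (Finset.mem_Icc.1 hk).1; omega)))
  have hv : ∏ k ∈ Finset.Icc 1 L, (1 + 2 * q ^ k * (1 - q ^ k)⁻¹)
      = ∏ k ∈ Finset.Icc 1 L, (1 + q ^ k) / (1 - q ^ k) := by
    refine Finset.prod_congr rfl fun k hk => ?_
    have hk' : 1 - q ^ k ≠ 0 := sub_ne_zero.2 (pow_ne_one_of_norm hq1
      (by have := (Finset.mem_Icc.1 hk).1; omega)).symm
    field_simp
    ring
  rw [hv] at h
  refine h.mono ?_
  refine (Finset.prod_le_prod (g := fun k => Real.exp (2 * ‖q‖ ^ k * (1 - ‖q‖)⁻¹))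
    (fun k _ => by positivity) fun k _ => ?_).trans ?_
  · rw [add_comm]; exact Real.add_one_le_exp _
  · rw [← Real.exp_sum]
    exact Real.exp_le_exp.2 (hg.sum_le_tsum _ fun k _ => by positivity)

/-- The value at `z` of the `n`-th term of the rank generating function. -/
noncomputable def rankTerm (d n : ℕ) (z q : ℂ) : ℂ :=
  (1 - z) * (1 - z⁻¹) * (-1) ^ n * q ^ (n ^ 2 + d * n)
    * (1 - z * q ^ (d * n))⁻¹ * (1 - z⁻¹ * q ^ (d * n))⁻¹

theorem evalsTo_oTerm {q : ℂ} (hq1 : ‖q‖ < 1) {u : ℂˣ} (hu : ‖(u : ℂ)‖ = 1) {d n : ℕ}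
    (hd : d ≠ 0) (hn : n ≠ 0) :
    EvalsTo q (specialize u (oTerm d n)) (rankTerm d n u q)
      (4 * (1 - ‖q‖)⁻¹ * (1 - ‖q‖)⁻¹ * ‖q‖ ^ n) := by
  have hdn : d * n ≠ 0 := mul_ne_zero hd hn
  have h := ((EvalsTo.monomial q ((1 - (u : ℂ)) * (1 - (u : ℂ)⁻¹) * (-1) ^ n)
    (n ^ 2 + d * n)).mul (evalsTo_geom hq1 hu 1 hdn)).mul (evalsTo_geom hq1 hu (-1) hdn)
  have e : specialize u (oTerm d n) = PowerSeries.C ((1 - (u : ℂ)) * (1 - (u : ℂ)⁻¹) * (-1) ^ n)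
      * PowerSeries.X ^ (n ^ 2 + d * n) * specialize u (geom 1 (d * n))
      * specialize u (geom (-1) (d * n)) := by
    simp only [oTerm, map_mul, map_sub, map_one, map_pow, map_neg, specialize_X, specialize_C_T,
      zpow_one, zpow_neg]
  rw [e]
  rw [zpow_one, zpow_neg_one] at h
  refine h.mono ?_
  have hρ : 0 < 1 - ‖q‖ := by linarith
  have h1 : ‖(1 - (u : ℂ)) * (1 - (u : ℂ)⁻¹) * (-1) ^ n‖ ≤ 4 := by
    rw [norm_mul, norm_mul, norm_pow, norm_neg, norm_one, one_pow, mul_one]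
    have h2 := norm_sub_le 1 (u : ℂ)
    have h3 := norm_sub_le 1 (u : ℂ)⁻¹
    rw [norm_inv, hu, norm_one] at h3
    rw [hu, norm_one] at h2
    nlinarith [norm_nonneg (1 - (u : ℂ)), norm_nonneg (1 - (u : ℂ)⁻¹)]
  have h2 : ‖q‖ ^ (n ^ 2 + d * n) ≤ ‖q‖ ^ n :=
    pow_le_pow_of_le_one (norm_nonneg _) hq1.le (by
      nlinarith [Nat.zero_le (d * n), Nat.one_le_iff_ne_zero.2 hn])
  calc _ ≤ 4 * ‖q‖ ^ n * (1 - ‖q‖)⁻¹ * (1 - ‖q‖)⁻¹ := by gcongr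
    _ = _ := by ring

theorem summable_rankTerm {q : ℂ} (hq1 : ‖q‖ < 1) {u : ℂˣ} (hu : ‖(u : ℂ)‖ = 1) {d : ℕ}
    (hd : d ≠ 0) : Summable fun n : ℕ => rankTerm d (n + 1) u q := by
  refine Summable.of_norm_bounded (((summable_nat_add_iff 1).2
    (summable_geometric_of_lt_one (norm_nonneg q) hq1)).mul_left
      (4 * (1 - ‖q‖)⁻¹ * (1 - ‖q‖)⁻¹)) fun n => ?_
  have h := evalsTo_oTerm hq1 hu hd n.succ_ne_zero
  rw [← h.eq]
  exact (norm_tsum_le_tsum_norm h.summable).trans h.norm_le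

/-- The value at `z` of the rank generating function. -/
noncomputable def rankValue (d : ℕ) (z q : ℂ) : ℂ :=
  qPoch (-q) q / qPoch q q * (1 + 2 * ∑' n : ℕ, rankTerm d (n + 1) z q)

theorem tendsto_prod_Icc_div {q : ℂ} (hq1 : ‖q‖ < 1) :
    Tendsto (fun L => ∏ k ∈ Finset.Icc 1 L, (1 + q ^ k) / (1 - q ^ k)) atTop
      (𝓝 (qPoch (-q) q / qPoch q q)) := by
  refine ((tendsto_qPoch hq1 (-q)).div (tendsto_qPoch hq1 q) (qPoch_self_ne_zero hq1)).congr
    fun L => ?_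
  induction L with
  | zero => simp
  | succ L ih =>
    rw [Finset.prod_Icc_succ_top (by omega), ← ih, Pi.div_apply, Pi.div_apply,
      Finset.prod_range_succ, Finset.prod_range_succ, mul_div_mul_comm]
    ring

theorem hasSum_specialize_oSeries {q : ℂ} (hq1 : ‖q‖ < 1) {u : ℂˣ} (hu : ‖(u : ℂ)‖ = 1) {d : ℕ}
    (hd : d ≠ 0) :
    HasSum (fun n => evalAt u (PowerSeries.coeff n (oSeries d)) * q ^ n) (rankValue d u q) := by
  obtain ⟨B, hP⟩ := exists_evalsTo_prodTrunc hq1 hu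
  have hρ : 0 < 1 - ‖q‖ := by linarith
  set K := 4 * (1 - ‖q‖)⁻¹ * (1 - ‖q‖)⁻¹ with hK
  have hg := (summable_geometric_of_lt_one (norm_nonneg q) hq1).mul_left K
  have hT (L : ℕ) : EvalsTo q (specialize u (1 + 2 * ∑ n ∈ Finset.Icc 1 L, oTerm d n))
      (1 + 2 * ∑ n ∈ Finset.Icc 1 L, rankTerm d n u q) (1 + 2 * ∑' n, K * ‖q‖ ^ n) := by
    have h1 := EvalsTo.sum (Finset.Icc 1 L) fun n hn => evalsTo_oTerm (n := n) hq1 hu hd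
      (by have := (Finset.mem_Icc.1 hn).1; omega)
    have h2 := (EvalsTo.one q).add ((EvalsTo.const q 2).mul h1)
    rw [map_add, map_one, map_mul, map_sum, map_ofNat]
    rw [map_ofNat] at h2
    refine h2.mono ?_
    rw [Complex.norm_ofNat]
    gcongr
    exact hg.sum_le_tsum _ fun k _ => by positivity
  have hO (L : ℕ) := (hP L).mul (hT L)
  simp_rw [← map_mul] at hO
  -- The increment of the truncation splits into the change of the product and the new term of the
  -- sum; both bounds are O(|q|^(L+1)).
  have hd' (L : ℕ) := (((hP L).mul (evalsTo_two_mul_geom hq1 hu L.succ_ne_zero)).mul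
    (hT (L + 1))).add ((hP L).mul ((EvalsTo.const q 2).mul
      (evalsTo_oTerm hq1 hu hd L.succ_ne_zero)))
  have hdiff (L : ℕ) : specialize u (oTrunc d (L + 1)) - specialize u (oTrunc d L)
      = specialize u (prodTrunc L) * (PowerSeries.C 2 * PowerSeries.X ^ (L + 1)
          * specialize u (geom 0 (L + 1)))
          * specialize u (1 + 2 * ∑ n ∈ Finset.Icc 1 (L + 1), oTerm d n)
        + specialize u (prodTrunc L) * (PowerSeries.C 2 * specialize u (oTerm d (L + 1))) := by
    have h1 : specialize u (prodTrunc (L + 1)) = specialize u (prodTrunc L)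
        * (1 + PowerSeries.C 2 * PowerSeries.X ^ (L + 1) * specialize u (geom 0 (L + 1))) := by
      rw [specialize_prodTrunc, specialize_prodTrunc, Finset.prod_Icc_succ_top (by omega)]
    have h2 : specialize u (1 + 2 * ∑ n ∈ Finset.Icc 1 (L + 1), oTerm d n)
        = specialize u (1 + 2 * ∑ n ∈ Finset.Icc 1 L, oTerm d n)
          + PowerSeries.C 2 * specialize u (oTerm d (L + 1)) := by
      rw [Finset.sum_Icc_succ_top (by omega), mul_add, ← add_assoc, map_add _ (_ + _),
        map_mul _ 2 (oTerm _ _), map_ofNat, map_ofNat]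
    rw [oTrunc, oTrunc, map_mul, map_mul, h1, h2]
    ring
  simp_rw [← hdiff] at hd'
  have hc (n L : ℕ) (h : n ≤ L) : PowerSeries.coeff n (specialize u (oTrunc d L))
      = PowerSeries.coeff n (specialize u (oSeries d)) := by
    rw [specialize, PowerSeries.coeff_map, PowerSeries.coeff_map, coeff_oTrunc_eq d h]
  obtain ⟨h1, h2⟩ := EvalsTo.tendsto_of_increments hc hO hd' (by
    have hs := (summable_nat_add_iff 1).2 (summable_geometric_of_lt_one (norm_nonneg q) hq1)
    refine ((hs.mul_left (B * (2 * (1 - ‖q‖)⁻¹) * (1 + 2 * ∑' n, K * ‖q‖ ^ n))).add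
      (hs.mul_left (B * (‖(2 : ℂ)‖ * K)))).congr fun L => ?_
    simp only [Nat.succ_eq_add_one]
    ring)
  have h3 : Tendsto (fun L => ∑ n ∈ Finset.Icc 1 L, rankTerm d n u q) atTop
      (𝓝 (∑' n : ℕ, rankTerm d (n + 1) u q)) := by
    refine (summable_rankTerm hq1 hu hd).hasSum.tendsto_sum_nat.congr fun L => ?_
    induction L with
    | zero => simp
    | succ L ih => rw [Finset.sum_range_succ, ih, Finset.sum_Icc_succ_top (by omega)]
  have h4 := tendsto_nhds_unique h2
    ((tendsto_prod_Icc_div hq1).mul ((h3.const_mul 2).const_add 1))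
  simp only [specialize, PowerSeries.coeff_map] at h1 h4
  rw [rankValue, ← h4]
  exact h1.hasSum

/-! ### The overpartition generating function -/

section Overpartitions

open scoped PowerSeries.WithPiTopology

theorem one_add_tsum_eq {k : ℕ} (hk : k ≠ 0) :
    (1 : PowerSeries ℂ) + ∑' j : ℕ, (2 : ℂ) • PowerSeries.X ^ (k * (j + 1))
      = 1 + PowerSeries.C 2 * PowerSeries.X ^ k * specialize 1 (geom 0 k) := by
  have hs := Nat.Partition.summable_genFun_term' (R := ℂ) (fun _ _ => 2) hk
  set S : PowerSeries ℂ := ∑' j : ℕ, (2 : ℂ) • PowerSeries.X ^ (k * (j + 1)) with hS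
  have h1 : S = PowerSeries.C 2 * PowerSeries.X ^ k + PowerSeries.X ^ k * S := by
    conv_lhs => rw [hS, hs.tsum_eq_zero_add]
    rw [hS, ← hs.tsum_mul_left]
    congr 1
    · rw [zero_add, mul_one, PowerSeries.smul_eq_C_mul]
    · refine tsum_congr fun j => ?_
      rw [PowerSeries.smul_eq_C_mul, PowerSeries.smul_eq_C_mul, mul_left_comm, ← pow_add]
      congr 2
      ring
  have h2 := specialize_geom_eq 1 0 hk
  rw [zpow_zero, map_one, one_mul] at h2
  generalize specialize 1 (geom 0 k) = g at *
  linear_combination g * h1 - S * h2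

/-- Weight 2 per distinct part size records whether its first occurrence is overlined. -/
theorem coeff_genFun_two (n : ℕ) :
    PowerSeries.coeff n (Nat.Partition.genFun fun _ _ => (2 : ℂ)) = pbar n := by
  rw [Nat.Partition.coeff_genFun, pbar, Fintype.card_sigma]
  push_cast
  refine Finset.sum_congr rfl fun p _ => ?_
  rw [Fintype.card_coe, Finset.card_powerset, Finsupp.prod, Multiset.toFinsupp_support]
  simp

/-- At z = 1 the factor 1 - z kills every term of the sum, leaving the product ∏ (1 + q^k)/(1 -
q^k). -/
theorem evalAt_one_coeff_oSeries (d n : ℕ) :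
    evalAt 1 (PowerSeries.coeff n (oSeries d)) = pbar n := by
  have h1 (L : ℕ) : specialize 1 (oTrunc d L)
      = ∏ i ∈ Finset.range L, ((1 : PowerSeries ℂ)
        + ∑' j : ℕ, (2 : ℂ) • PowerSeries.X ^ ((i + 1) * (j + 1))) := by
    have h0 (m : ℕ) : specialize 1 (oTerm d m) = 0 := by
      simp [oTerm, specialize_C_T]
    rw [oTrunc, map_mul, map_add, map_mul, map_sum, Finset.sum_eq_zero fun m _ => h0 m, map_one,
      mul_zero, add_zero, mul_one, specialize_prodTrunc]
    induction L with
    | zero => simp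
    | succ L ih =>
      rw [Finset.prod_Icc_succ_top (by omega), ih, Finset.prod_range_succ,
        one_add_tsum_eq L.succ_ne_zero]
  have h2 := (Nat.Partition.hasProd_genFun (R := ℂ) fun _ _ => 2).tendsto_prod_nat
  rw [PowerSeries.WithPiTopology.tendsto_iff_coeff_tendsto] at h2
  have h3 := h2 n
  rw [coeff_genFun_two] at h3
  refine tendsto_nhds_unique (tendsto_const_nhds.congr' ?_) h3
  filter_upwards [eventually_ge_atTop n] with L hL
  rw [← h1, specialize, PowerSeries.coeff_map, coeff_oTrunc_eq d hL]

end Overpartitions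

/-! ### Rank deviations as averages over roots of unity -/

theorem sum_zpow_pow_eq {ζ : ℂ} {M : ℕ} (hζ : IsPrimitiveRoot ζ M) (m : ℤ) :
    ∑ j ∈ Finset.range M, (ζ ^ m) ^ j = if (M : ℤ) ∣ m then (M : ℂ) else 0 := by
  split_ifs with h
  · rw [(hζ.zpow_eq_one_iff_dvd m).2 h]
    simp
  · have h1 : ζ ^ m ≠ 1 := fun h0 => h ((hζ.zpow_eq_one_iff_dvd m).1 h0)
    rw [geom_sum_eq h1, ← zpow_natCast, ← zpow_mul, mul_comm, zpow_mul, zpow_natCast,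
      hζ.pow_eq_one, one_zpow, sub_self, zero_div]

theorem sum_coeff_modEq {ζ : ℂ} {M : ℕ} (hM : M ≠ 0) (hζ : IsPrimitiveRoot ζ M) (u : ℂˣ)
    (hu : (u : ℂ) = ζ) (a : ℤ) (p : LaurentPolynomial ℤ) :
    ((∑ k ∈ p.coeff.support with k ≡ a [ZMOD M], p.coeff k : ℤ) : ℂ)
      = 1 / M * ∑ j ∈ Finset.range M, ζ ^ (-(a * j)) * evalAt (u ^ j) p := by
  have hζ0 : ζ ≠ 0 := hζ.ne_zero hM
  have hM' : (M : ℂ) ≠ 0 := by exact_mod_cast hM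
  simp_rw [evalAt_apply, Finset.mul_sum]
  rw [Finset.sum_comm, Finset.sum_filter]
  push_cast
  refine Finset.sum_congr rfl fun k _ => ?_
  have h := sum_zpow_pow_eq hζ (k - a)
  have h1 : ∀ j ∈ Finset.range M, 1 / (M : ℂ) * (ζ ^ (-(a * j))
      * ((p.coeff k : ℂ) * ((u : ℂ) ^ j) ^ k)) = 1 / M * p.coeff k * (ζ ^ (k - a)) ^ j := by
    intro j _
    rw [hu, ← zpow_natCast, ← zpow_natCast, ← zpow_mul, ← zpow_mul,
      sub_mul, sub_eq_add_neg, zpow_add₀ hζ0, mul_comm (j : ℤ) k]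
    ring
  rw [Finset.sum_congr rfl h1, ← Finset.mul_sum, h]
  have h2 : k ≡ a [ZMOD M] ↔ (M : ℤ) ∣ k - a :=
    ⟨fun h => h.symm.dvd, fun h => (Int.modEq_iff_dvd.2 h).symm⟩
  simp only [h2]
  split_ifs with h3
  · field_simp
  · simp

theorem devCoeff_eq {ζ : ℂ} {M : ℕ} (hM : M ≠ 0) (hζ : IsPrimitiveRoot ζ M) (u : ℂˣ)
    (hu : (u : ℂ) = ζ) (d : ℕ) (a : ℤ) (n : ℕ) :
    devCoeff d a M n = 1 / M * ∑ j ∈ Finset.Icc 1 (M - 1), ζ ^ (-(a * j))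
      * evalAt (u ^ j) (PowerSeries.coeff n (oSeries d)) := by
  have h := sum_coeff_modEq hM hζ u hu a (PowerSeries.coeff n (oSeries d))
  rw [devCoeff, NbarMod]
  simp only [Nbar]
  rw [h, Finset.range_eq_Ico, Finset.sum_eq_sum_Ico_succ_bot (by omega)]
  have h2 : Finset.Ico (0 + 1) M = Finset.Icc 1 (M - 1) := by ext; simp; omega
  rw [h2, pow_zero, evalAt_one_coeff_oSeries]
  simp
  ring

theorem hasSum_devCoeff {q : ℂ} (hq1 : ‖q‖ < 1) {ζ : ℂ} {M : ℕ} (hM : M ≠ 0)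
    (hζ : IsPrimitiveRoot ζ M) {d : ℕ} (hd : d ≠ 0) (a : ℤ) :
    HasSum (fun n => devCoeff d a M n * q ^ n)
      (1 / M * ∑ j ∈ Finset.Icc 1 (M - 1), ζ ^ (-(a * j)) * rankValue d (ζ ^ j) q) := by
  have hζ0 : ζ ≠ 0 := hζ.ne_zero hM
  have hζ1 : ‖ζ‖ = 1 := hζ.norm'_eq_one hM
  let u : ℂˣ := Units.mk0 ζ hζ0
  have h : HasSum (fun n => 1 / (M : ℂ) * ∑ j ∈ Finset.Icc 1 (M - 1), ζ ^ (-(a * j))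
      * (evalAt (u ^ j) (PowerSeries.coeff n (oSeries d)) * q ^ n))
      (1 / M * ∑ j ∈ Finset.Icc 1 (M - 1), ζ ^ (-(a * j)) * rankValue d (ζ ^ j) q) := by
    refine (hasSum_sum fun j _ => ?_).mul_left _
    have := hasSum_specialize_oSeries hq1 (u := u ^ j) (by simp [u, hζ1]) hd
    simpa [u] using this.mul_left (ζ ^ (-(a * j)))
  convert! h using 2 with n
  rw [devCoeff_eq hM hζ u rfl, mul_assoc, Finset.sum_mul]
  simp_rw [mul_assoc]

/-! ### The rank generating function as a bilateral series -/

theorem norm_sq_lt_one {q : ℂ} (hq1 : ‖q‖ < 1) : ‖q ^ 2‖ < 1 := by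
  rw [norm_pow]; exact pow_lt_one₀ (norm_nonneg _) hq1 two_ne_zero

theorem qPoch_self_eq_mul {q : ℂ} (hq1 : ‖q‖ < 1) :
    qPoch q q = qPoch q (q ^ 2) * qPoch (q ^ 2) (q ^ 2) := by
  have hq2 := norm_sq_lt_one hq1
  refine tendsto_nhds_unique ((tendsto_qPoch hq1 q).comp (tendsto_id.const_mul_atTop' two_pos)) ?_
  refine ((tendsto_qPoch hq2 q).mul (tendsto_qPoch hq2 (q ^ 2))).congr fun N => ?_
  simp only [Function.comp, id]
  induction N with
  | zero => simp
  | succ N ih =>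
    rw [show 2 * (N + 1) = 2 * N + 1 + 1 by ring, Finset.prod_range_succ _ (2 * N + 1),
      Finset.prod_range_succ _ (2 * N),
      ← ih, Finset.prod_range_succ, Finset.prod_range_succ]
    ring

theorem qPoch_sq_eq_mul {q : ℂ} (hq1 : ‖q‖ < 1) :
    qPoch (q ^ 2) (q ^ 2) = qPoch q q * qPoch (-q) q := by
  have hq2 := norm_sq_lt_one hq1
  refine tendsto_nhds_unique (tendsto_qPoch hq2 (q ^ 2)) ?_
  refine ((tendsto_qPoch hq1 q).mul (tendsto_qPoch hq1 (-q))).congr fun N => ?_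
  rw [← Finset.prod_mul_distrib]
  exact Finset.prod_congr rfl fun k _ => by ring

/-- Gauss's product for `∑ (-1) ^ n q ^ n ^ 2`. -/
theorem jTheta_self_sq_mul {q : ℂ} (hq0 : q ≠ 0) (hq1 : ‖q‖ < 1) :
    jTheta q (q ^ 2) * qPoch (-q) q = qPoch q q := by
  have h1 := qPoch_self_eq_mul hq1
  -- Together these two factorizations give Euler's identity (q; q²)_∞ (-q; q)_∞ = 1.
  have h2 := qPoch_sq_eq_mul hq1
  have h3 : q ^ 2 / q = q := by field_simp
  rw [jTheta, h3]
  rw [h2] at h1 ⊢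
  linear_combination (-qPoch q (q ^ 2) * qPoch (-q) q - 1) * h1

theorem gauss_term_eq {q : ℂ} (hq0 : q ≠ 0) (n : ℤ) :
    (-1 : ℂ) ^ n * (q ^ 2) ^ choose2 n * q ^ n = (-1) ^ n * q ^ (n ^ 2) := by
  have h : q ^ (n ^ 2) = (q ^ 2) ^ choose2 n * q ^ n := by
    rw [← zpow_natCast q 2, ← zpow_mul, ← zpow_add₀ hq0]
    congr 1
    linear_combination -two_mul_choose2 n
  rw [h, mul_assoc]

theorem summable_norm_gauss {q : ℂ} (hq0 : q ≠ 0) (hq1 : ‖q‖ < 1) :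
    Summable fun n : ℤ => ‖(-1 : ℂ) ^ n * q ^ (n ^ 2)‖ := by
  have := summable_norm_theta (pow_ne_zero 2 hq0) (norm_sq_lt_one hq1) hq0
  simpa only [gauss_term_eq hq0] using this

theorem tsum_gauss {q : ℂ} (hq0 : q ≠ 0) (hq1 : ‖q‖ < 1) :
    ∑' n : ℤ, (-1 : ℂ) ^ n * q ^ (n ^ 2) = jTheta q (q ^ 2) := by
  rw [jTheta_eq_tsum (pow_ne_zero 2 hq0) (norm_sq_lt_one hq1) hq0]
  simp only [gauss_term_eq hq0]

/-- The bilateral series `∑ (-1) ^ n q ^ n ^ 2 / (1 - z q ^ (d n))`. -/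
noncomputable def rankSum (d : ℕ) (z q : ℂ) : ℂ :=
  ∑' n : ℤ, (-1 : ℂ) ^ n * q ^ (n ^ 2) / (1 - (q ^ d) ^ n * z)

theorem norm_pow_lt_one {q : ℂ} (hq1 : ‖q‖ < 1) {d : ℕ} (hd : d ≠ 0) : ‖q ^ d‖ < 1 := by
  rw [norm_pow]; exact pow_lt_one₀ (norm_nonneg _) hq1 hd

theorem summable_rankSum {q z : ℂ} (hq0 : q ≠ 0) (hq1 : ‖q‖ < 1) (hz : z ≠ 0) {d : ℕ}
    (hd : d ≠ 0) :
    Summable fun n : ℤ => (-1 : ℂ) ^ n * q ^ (n ^ 2) / (1 - (q ^ d) ^ n * z) := by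
  obtain ⟨B, hB, h⟩ := exists_norm_inv_le (pow_ne_zero d hq0) (norm_pow_lt_one hq1 hd) hz
  refine Summable.of_norm_bounded ((summable_norm_gauss hq0 hq1).mul_right B) fun r => ?_
  rw [div_eq_mul_inv, norm_mul]
  exact mul_le_mul_of_nonneg_left (h _) (norm_nonneg _)

theorem tsum_int_eq_zero_add {f : ℤ → ℂ} (hf : Summable f) :
    Summable (fun n : ℕ => f (n + 1) + f (-(n + 1))) ∧
      ∑' n, f n = f 0 + ∑' n : ℕ, (f (n + 1) + f (-(n + 1))) := by
  have h1 : Summable fun n : ℕ => f n := hf.comp_injective Nat.cast_injective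
  have h2 : Summable fun n : ℕ => f (-(n + 1)) :=
    hf.comp_injective (i := fun n : ℕ => -((n : ℤ) + 1)) fun a b h => by
      simp only at h; omega
  have h3 : Summable fun n : ℕ => f (n + 1) := by
    simpa using (summable_nat_add_iff 1).2 h1
  refine ⟨h3.add h2, ?_⟩
  rw [tsum_of_nat_of_neg_add_one h1 h2, h1.tsum_eq_zero_add, h3.tsum_add h2, add_assoc]
  simp

theorem one_sub_zpow_mul_ne_zero_of_norm {p z : ℂ} (hp1 : ‖p‖ < 1) (hz : ‖z‖ = 1)
    (hz1 : z ≠ 1) (n : ℤ) : 1 - p ^ n * z ≠ 0 := by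
  refine one_sub_zpow_mul_ne_zero (fun r hr => hz1 ?_) n
  have h2 : ‖p‖ ^ r = 1 := by rw [← norm_zpow, ← hr, hz]
  rw [zpow_eq_one_iff_right₀ (norm_nonneg _) hp1.ne] at h2
  rw [hr, h2, zpow_zero]

/-- The rank generating function in terms of a bilateral series. -/
theorem one_add_mul_rankValue {q z : ℂ} (hq0 : q ≠ 0) (hq1 : ‖q‖ < 1) (hz : ‖z‖ = 1)
    (hz1 : z ≠ 1) {d : ℕ} (hd : d ≠ 0) :
    (1 + z) * rankValue d z q
      = (1 - z) * (2 * (rankSum d z q / jTheta q (q ^ 2)) - 1) := by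
  have hz0 : z ≠ 0 := by rintro rfl; simp at hz
  have hp := jTheta_self_sq_mul hq0 hq1
  have hP := qPoch_self_ne_zero hq1
  have hθ : jTheta q (q ^ 2) ≠ 0 := fun h => hP (by rw [← hp, h, zero_mul])
  have hr : qPoch (-q) q / qPoch q q = (jTheta q (q ^ 2))⁻¹ := by
    rw [← hp]
    have : qPoch (-q) q ≠ 0 := fun h => hP (by rw [← hp, h, mul_zero])
    field_simp
  have hg := (summable_norm_gauss hq0 hq1).of_norm
  obtain ⟨hs1, h1⟩ := tsum_int_eq_zero_add (summable_rankSum hq0 hq1 hz0 hd)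
  obtain ⟨hs2, h2⟩ := tsum_int_eq_zero_add hg
  have h3 := summable_rankTerm hq1 (u := Units.mk0 z hz0) hz hd
  rw [Units.val_mk0] at h3
  rw [tsum_gauss hq0 hq1] at h2
  -- Partial fractions with y = q^(d(n+1)), pairing the indices n + 1 and -(n + 1). The factor 1 + z
  -- is never divided out, so z = -1 (which occurs for even M) is covered.
  have key (n : ℕ) : (1 + z) * (2 * rankTerm d (n + 1) z q)
      = (1 - z) * (2 * ((-1 : ℂ) ^ ((n : ℤ) + 1) * q ^ (((n : ℤ) + 1) ^ 2)
          / (1 - (q ^ d) ^ ((n : ℤ) + 1) * z)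
        + (-1 : ℂ) ^ (-((n : ℤ) + 1)) * q ^ ((-((n : ℤ) + 1)) ^ 2)
          / (1 - (q ^ d) ^ (-((n : ℤ) + 1)) * z))
        - ((-1 : ℂ) ^ ((n : ℤ) + 1) * q ^ (((n : ℤ) + 1) ^ 2)
          + (-1 : ℂ) ^ (-((n : ℤ) + 1)) * q ^ ((-((n : ℤ) + 1)) ^ 2))) := by
    have e1 := one_sub_zpow_mul_ne_zero_of_norm (norm_pow_lt_one hq1 hd) hz hz1 ((n : ℤ) + 1)
    have e2 := one_sub_zpow_mul_ne_zero_of_norm (norm_pow_lt_one hq1 hd) hz hz1 (-((n : ℤ) + 1))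
    have e3 : (-1 : ℂ) ^ (-((n : ℤ) + 1)) = (-1) ^ ((n : ℤ) + 1) := by
      rw [zpow_neg, ← inv_zpow, inv_neg_one]
    rw [e3, neg_sq]
    rw [zpow_neg] at e2 ⊢
    have e4 : ((n : ℤ) + 1) = ((n + 1 : ℕ) : ℤ) := by push_cast; rfl
    rw [e4] at e1 e2 ⊢
    rw [zpow_natCast] at e1 e2
    rw [rankTerm, zpow_natCast, zpow_natCast, pow_add q, pow_mul q d, ← Nat.cast_pow, zpow_natCast]
    have hy : (q ^ d) ^ (n + 1) ≠ 0 := pow_ne_zero _ (pow_ne_zero _ hq0)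
    generalize (q ^ d) ^ (n + 1) = y at *
    generalize q ^ (n + 1) ^ 2 = c at *
    generalize (-1 : ℂ) ^ (n + 1) = s at *
    have e5 : y - z ≠ 0 := fun h0 => e2 (by rw [sub_eq_zero.1 h0, inv_mul_cancel₀ hz0, sub_self])
    have e6 : z - y ≠ 0 := fun h0 => e5 (by linear_combination -h0)
    have e7 : 1 - z * y ≠ 0 := by rwa [mul_comm]
    have f1 : 1 - z⁻¹ * y = (z - y) / z := by field_simp
    have f2 : 1 - y⁻¹ * z = -(z - y) / y := by field_simp; ring
    rw [f1, f2, mul_comm y z]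
    field_simp
    ring
  have hsum := congrArg tsum (funext key)
  rw [tsum_mul_left, tsum_mul_left, tsum_mul_left, (hs1.mul_left 2).tsum_sub hs2, tsum_mul_left]
    at hsum
  have h0 : (1 : ℂ) - z ≠ 0 := sub_ne_zero.2 hz1.symm
  rw [rankValue, hr, rankSum, h1]
  simp only [zpow_zero, one_mul, ne_eq, OfNat.ofNat_ne_zero, not_false_eq_true, zero_pow] at h2 ⊢
  generalize ∑' n : ℕ, rankTerm d (n + 1) z q = R at *
  generalize ∑' n : ℕ, ((-1 : ℂ) ^ ((n : ℤ) + 1) * q ^ (((n : ℤ) + 1) ^ 2)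
          / (1 - (q ^ d) ^ ((n : ℤ) + 1) * z)
        + (-1 : ℂ) ^ (-((n : ℤ) + 1)) * q ^ ((-((n : ℤ) + 1)) ^ 2)
          / (1 - (q ^ d) ^ (-((n : ℤ) + 1)) * z)) = S at *
  generalize ∑' n : ℕ, ((-1 : ℂ) ^ ((n : ℤ) + 1) * q ^ (((n : ℤ) + 1) ^ 2)
          + (-1 : ℂ) ^ (-((n : ℤ) + 1)) * q ^ ((-((n : ℤ) + 1)) ^ 2)) = T at *
  generalize jTheta q (q ^ 2) = θ at *
  field_simp
  linear_combination hsum + (1 - z) * h2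

/-! ### The bilateral series as an Appell--Lerch series -/

theorem zpow_norm_injective {q : ℂ} (hq0 : q ≠ 0) (hq1 : ‖q‖ < 1) {m n : ℤ}
    (h : ‖q‖ ^ m = ‖q‖ ^ n) : m = n :=
  zpow_right_injective₀ (norm_pos_iff.2 hq0) hq1.ne h

theorem appellLerch_mul {q x z : ℂ} (hq0 : q ≠ 0) (hq1 : ‖q‖ < 1) (hx : x ≠ 0)
    (hz : Generic x q z) :
    appellLerch (q * x) q z = 1 - x * appellLerch x q z := by
  obtain ⟨hz0, hz1, hz2⟩ := hz
  have hj := jTheta_ne_zero hq0 hq1 hz0 hz1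
  have hm : (-1 : ℂ) ≠ 0 := by norm_num
  have hs := (summable_norm_lerchSum hq0 hq1 (mul_ne_zero hx hz0) hz0).of_norm
  have hθ := hasSum_jTheta hq0 hq1 hz0
  rw [← (Equiv.subRight (1 : ℤ)).hasSum_iff] at hθ
  have key : lerchSum q (q * x * z) z = jTheta z q - x * lerchSum q (x * z) z := by
    have h := hθ.sub (hs.hasSum.mul_left x)
    rw [lerchSum, ← (Equiv.subRight (1 : ℤ)).tsum_eq]
    refine Eq.trans (tsum_congr fun r => ?_) h.tsum_eq
    simp only [Function.comp, Equiv.subRight_apply]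
    have h0 := one_sub_zpow_mul_ne_zero hz2 (r - 1)
    have e : 1 - q ^ (r - 1 - 1) * (q * x * z) = 1 - q ^ (r - 1) * (x * z) := by
      rw [zpow_sub_one₀ hq0 (r - 1)]; field_simp
    have hc : q ^ choose2 r = q ^ choose2 (r - 1) * q ^ (r - 1) := by
      rw [← zpow_add₀ hq0, choose2_sub_one]; congr 1; ring
    have hm' : (-1 : ℂ) ^ r = (-1) ^ (r - 1) * -1 := by
      rw [← zpow_add_one₀ hm, sub_add_cancel]
    have hz' : z ^ r = z ^ (r - 1) * z := by rw [← zpow_add_one₀ hz0, sub_add_cancel]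
    rw [e, hc, hm', hz']
    generalize q ^ (r - 1) = v at *
    rw [← mul_assoc] at h0
    field_simp
    ring
  rw [appellLerch_eq_lerchSum, appellLerch_eq_lerchSum, key]
  field_simp

/-- Completing the square after r ↦ r + N produces v/(1 - vz) with v = q^(2Nr), which is z⁻¹(1/(1 -
vz) - 1). The left side is the form in which the dissection yields this series. -/
theorem tsum_rankSum_shift {q z : ℂ} (hq0 : q ≠ 0) (hq1 : ‖q‖ < 1) (hz : ‖z‖ = 1) (hz1 : z ≠ 1)
    {N : ℕ} (hN : N ≠ 0) :
    ∑' r : ℤ, (-1 : ℂ) ^ r * q ^ (r ^ 2) / (1 - (q ^ (2 * N)) ^ (r - N) * z)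
      = (-1) ^ N * q ^ N ^ 2 * z⁻¹ * (rankSum (2 * N) z q - jTheta q (q ^ 2)) := by
  have hz0 : z ≠ 0 := by rintro rfl; simp at hz
  have hd : 2 * N ≠ 0 := by omega
  have hm : (-1 : ℂ) ≠ 0 := by norm_num
  rw [← (Equiv.addRight (N : ℤ)).tsum_eq, rankSum, ← tsum_gauss hq0 hq1,
    ← (summable_rankSum hq0 hq1 hz0 hd).tsum_sub (summable_norm_gauss hq0 hq1).of_norm,
    ← tsum_mul_left]
  refine tsum_congr fun r => ?_
  have h0 := one_sub_zpow_mul_ne_zero_of_norm (norm_pow_lt_one hq1 hd) hz hz1 r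
  have e : q ^ ((r + N) ^ 2) = q ^ (r ^ 2) * (q ^ (2 * N)) ^ r * q ^ N ^ 2 := by
    rw [← zpow_natCast q (2 * N), ← zpow_natCast q (N ^ 2), ← zpow_mul, ← zpow_add₀ hq0,
      ← zpow_add₀ hq0]
    congr 1
    push_cast
    ring
  simp only [Equiv.coe_addRight, add_sub_cancel_right]
  rw [e, zpow_add₀ hm, zpow_natCast]
  field_simp
  ring

theorem rankSum_div_eq {q z w : ℂ} (hq0 : q ≠ 0) (hq1 : ‖q‖ < 1) (hz : ‖z‖ = 1) (hz1 : z ≠ 1)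
    {N : ℕ} (hN : N ≠ 0) (hw : w ^ N = z) :
    rankSum (2 * N) z q / jTheta q (q ^ 2)
      = appellLerch (z * ((-1) ^ (N + 1) * q ^ N ^ 2)) (q ^ (2 * N ^ 2)) (-1)
        + (-1) ^ N * q ^ (-(N : ℤ) ^ 2) * z
          * Psi 0 N (w * q ^ (1 - ((2 * N : ℕ) : ℤ))) q (-1) (q ^ 2) := by
  have hz0 : z ≠ 0 := by rintro rfl; simp at hz
  have hw0 : w ≠ 0 := by rintro rfl; exact hz0 (by rw [← hw, zero_pow hN])
  have hQ : (q ^ 2) ^ N ^ 2 = q ^ (2 * N ^ 2) := (pow_mul _ _ _).symm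
  have hQ0 : q ^ (2 * N ^ 2) ≠ 0 := pow_ne_zero _ hq0
  have hQ1 : ‖q ^ (2 * N ^ 2)‖ < 1 := norm_pow_lt_one hq1 (by positivity)
  set x := w * q ^ (1 - ((2 * N : ℕ) : ℤ)) with hx
  have hx0 : x ≠ 0 := mul_ne_zero hw0 (zpow_ne_zero _ hq0)
  set X := (-1) ^ (N + 1) * z * q ^ (-(N : ℤ) ^ 2) with hX
  have hX0 : X ≠ 0 := mul_ne_zero (mul_ne_zero (pow_ne_zero _ (by norm_num)) hz0)
    (zpow_ne_zero _ hq0)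
  have hXeq : -((q ^ 2) ^ (choose2 N - N * 0) * (-x) ^ N) = X := by
    have e : (q ^ 2) ^ (choose2 (N : ℤ)) * (q ^ (1 - ((2 * N : ℕ) : ℤ))) ^ N
        = q ^ (-(N : ℤ) ^ 2) := by
      rw [← zpow_natCast q 2, ← zpow_mul, ← zpow_natCast (q ^ _) N, ← zpow_mul, ← zpow_add₀ hq0]
      congr 1
      push_cast
      linear_combination two_mul_choose2 N
    rw [mul_zero, sub_zero, neg_pow x, hx, mul_pow, hw, hX, ← e]
    ring
  have hzn (r : ℤ) : ‖(q ^ (2 * N ^ 2)) ^ r‖ = ‖q‖ ^ (2 * (N : ℤ) ^ 2 * r) := by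
    rw [norm_zpow, norm_pow, ← zpow_natCast, ← zpow_mul]
    push_cast
    rfl
  have hN2 : (0 : ℤ) < (N : ℤ) ^ 2 := by positivity
  have hgen : Generic X (q ^ (2 * N ^ 2)) (-1) := by
    refine ⟨by norm_num, fun r hr => ?_, fun r hr => ?_⟩
    · have h := congrArg norm hr
      rw [hzn, norm_neg, norm_one, ← zpow_zero ‖q‖] at h
      have h2 := zpow_norm_injective hq0 hq1 h
      have h3 : r = 0 := by
        rcases mul_eq_zero.1 h2.symm with h | h
        · omega
        · exact h
      rw [h3, zpow_zero] at hr
      norm_num at hr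
    · have h := congrArg norm hr
      rw [hzn, norm_mul, hX, norm_mul, norm_mul, norm_pow, norm_neg, norm_one, one_pow, one_mul,
        mul_one, hz, one_mul, norm_zpow] at h
      have h2 := zpow_norm_injective hq0 hq1 h
      have h3 : (N : ℤ) ^ 2 * (2 * r + 1) = 0 := by linear_combination -h2
      rcases mul_eq_zero.1 h3 with h | h <;> omega
  have hxq : (x * q) ^ N = z * q ^ ((2 - 2 * (N : ℤ)) * N) := by
    rw [hx, mul_assoc, ← zpow_add_one₀ hq0, mul_pow, hw, ← zpow_natCast (q ^ _) N, ← zpow_mul]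
    congr 2
    push_cast
    ring
  have hmain := tsum_eq_appellLerch_add_Psi (pow_ne_zero 2 hq0) (norm_sq_lt_one hq1) hx0 hq0
    (fun r hr => by
      have h := congrArg norm hr
      rw [← zpow_natCast, ← zpow_mul, norm_zpow] at h
      nth_rewrite 1 [← zpow_one ‖q‖] at h
      have h2 := zpow_norm_injective hq0 hq1 h
      push_cast at h2
      omega) hN 0 (w := -1) (by rw [hXeq, hQ]; exact hgen)
    -- Comparing norms forces t + 1 = N(1 + r) with 1 ≤ t + 1 ≤ N, hence r = 0, and the equation
    -- collapses to the excluded z = 1.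
    (fun t ht r hr => by
      rw [hQ, hxq] at hr
      have e : (q ^ 2) ^ (N * t) * (z * q ^ ((2 - 2 * (N : ℤ)) * N))
          = z * q ^ (2 * (N : ℤ) * (t + 1 - N)) := by
        rw [mul_left_comm, ← pow_mul, ← zpow_natCast, ← zpow_add₀ hq0]
        congr 2
        push_cast
        ring
      rw [e] at hr
      have h := congrArg norm hr
      rw [hzn, norm_mul, hz, one_mul, norm_zpow] at h
      have h2 := zpow_norm_injective hq0 hq1 h
      have h3 : (2 * (N : ℤ)) * (t + 1 - N - N * r) = 0 := by linear_combination h2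
      have h4 : (t : ℤ) + 1 = N * (1 + r) := by
        rcases mul_eq_zero.1 h3 with h | h
        · omega
        · linear_combination h
      have h5 : r = 0 := by
        have hN0 : (0 : ℤ) < N := by positivity
        have ht' : (t : ℤ) + 1 ≤ N := by omega
        have l1 : 0 < 1 + r := by
          by_contra hcon
          nlinarith [mul_nonneg hN0.le (show 0 ≤ -(1 + r) by omega)]
        have l2 : r ≤ 0 := by
          by_contra hcon
          nlinarith
        omega
      subst h5
      rw [show (t : ℤ) + 1 - N = 0 by linear_combination h4, mul_zero, zpow_zero, zpow_zero,
        mul_one] at hr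
      exact hz1 hr)
  have hlhs : ∑' r : ℤ, (-1 : ℂ) ^ r * (q ^ 2) ^ choose2 r * q ^ r
        * ((q ^ 2) ^ (r - 1) * (x * q)) ^ (0 : ℤ) / (1 - ((q ^ 2) ^ (r - 1) * (x * q)) ^ N)
      = ∑' r : ℤ, (-1 : ℂ) ^ r * q ^ (r ^ 2) / (1 - (q ^ (2 * N)) ^ (r - N) * z) := by
    refine tsum_congr fun r => ?_
    have e : (q ^ 2) ^ ((r - 1) * (N : ℤ)) * q ^ ((2 - 2 * (N : ℤ)) * N)
        = (q ^ (2 * N)) ^ (r - N) := by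
      rw [← zpow_natCast q 2, ← zpow_natCast q (2 * N), ← zpow_mul, ← zpow_mul, ← zpow_add₀ hq0]
      congr 1
      push_cast
      ring
    rw [zpow_zero, mul_one, gauss_term_eq hq0, mul_pow, hxq, ← e, ← zpow_natCast (_ ^ (r - 1)) N,
      ← zpow_mul]
    ring
  rw [hlhs, tsum_rankSum_shift hq0 hq1 hz hz1 hN, zero_add, choose2_one, neg_zero, zpow_zero,
    zpow_zero, one_mul, one_mul, hXeq, hQ] at hmain
  have hθ : jTheta q (q ^ 2) ≠ 0 := fun h =>
    qPoch_self_ne_zero hq1 (by rw [← jTheta_self_sq_mul hq0 hq1, h, zero_mul])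
  -- Multiplying X by the nome q^(2N²) replaces q^(-N²) by q^(N²), the symmetric form wanted; the
  -- resulting constant 1 absorbs the θ term of the shift.
  have hshift := appellLerch_mul hQ0 hQ1 hX0 hgen
  have e1 : q ^ (2 * N ^ 2) * X = z * ((-1) ^ (N + 1) * q ^ N ^ 2) := by
    rw [hX, two_mul, pow_add q, zpow_neg, ← Nat.cast_pow, zpow_natCast]
    have := pow_ne_zero (N ^ 2) hq0
    field_simp
  rw [e1] at hshift
  rw [hshift]
  have hqN : q ^ N ^ 2 ≠ 0 := pow_ne_zero _ hq0
  have hsq : ((-1 : ℂ) ^ N) * (-1) ^ N = 1 := by rw [← mul_pow]; simp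
  rw [hX, zpow_neg, ← Nat.cast_pow, zpow_natCast] at *
  generalize appellLerch _ _ _ = A at *
  generalize Psi _ _ _ _ _ _ = P at *
  rw [pow_succ]
  field_simp at hmain ⊢
  linear_combination (-1) ^ N * hmain - (q ^ N ^ 2 * (rankSum (2 * N) z q - jTheta q (q ^ 2))) * hsq

/-! ### Averages over roots of unity -/

/-- Write 1/(1 - ζ^j u) as a geometric sum of length M over 1 - u^M; orthogonality keeps the single
exponent i = k, which lies in the range because 0 ≤ k < M. -/
theorem sum_root_filter {ζ u : ℂ} {M : ℕ} (hM : M ≠ 0) (hζ : IsPrimitiveRoot ζ M) {k : ℤ}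
    (hk0 : 0 ≤ k) (hkM : k < M) (hu : u ^ M ≠ 1) :
    ∑ j ∈ Finset.range M, ζ ^ (-(k * j)) / (1 - ζ ^ j * u) = M * (u ^ k / (1 - u ^ M)) := by
  have hζ0 : ζ ≠ 0 := hζ.ne_zero hM
  lift k to ℕ using hk0
  have hu' : 1 - u ^ M ≠ 0 := sub_ne_zero.2 hu.symm
  have h1 (j : ℕ) : ζ ^ (-((k : ℤ) * j)) / (1 - ζ ^ j * u)
      = (∑ i ∈ Finset.range M, u ^ i * (ζ ^ ((i : ℤ) - k)) ^ j) / (1 - u ^ M) := by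
    have h2 : (ζ ^ j * u) ^ M = u ^ M := by
      rw [mul_pow, ← pow_mul, mul_comm j, pow_mul, hζ.pow_eq_one, one_pow, one_mul]
    have h3 : 1 - ζ ^ j * u ≠ 0 := fun h => hu (by rw [← h2, ← sub_eq_zero.1 h, one_pow])
    have h4 := mul_neg_geom_sum (ζ ^ j * u) M
    rw [h2] at h4
    rw [div_eq_div_iff h3 hu', ← h4, mul_comm (1 - ζ ^ j * u), ← mul_assoc, Finset.mul_sum]
    congr 1
    refine Finset.sum_congr rfl fun i _ => ?_
    rw [mul_pow, ← zpow_natCast (ζ ^ (_ : ℤ)), ← zpow_mul, sub_mul, sub_eq_add_neg, zpow_add₀ hζ0,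
      ← pow_mul, ← zpow_natCast ζ (j * i)]
    push_cast
    rw [mul_comm (j : ℤ)]
    ring
  simp_rw [h1]
  rw [← Finset.sum_div, Finset.sum_comm]
  simp_rw [← Finset.mul_sum, sum_zpow_pow_eq hζ]
  rw [Finset.sum_eq_single_of_mem k (Finset.mem_range.2 (by omega))]
  · simp
    ring
  · intro i hi hik
    rw [if_neg, mul_zero]
    intro hdvd
    have hi' := Finset.mem_range.1 hi
    have := Int.eq_zero_of_abs_lt_dvd hdvd (by rw [abs_lt]; omega)
    omega

theorem sum_appellLerch_root {q x z ζ : ℂ} (hq0 : q ≠ 0) (hq1 : ‖q‖ < 1) (hx : x ≠ 0)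
    (hz : z ≠ 0) {M : ℕ} (hM : M ≠ 0) (hζ : IsPrimitiveRoot ζ M) {k : ℤ} (hk0 : 0 ≤ k)
    (hkM : k < M) (h : ∀ r : ℤ, (q ^ r * (x * z)) ^ M ≠ 1) :
    ∑ j ∈ Finset.range M, ζ ^ (-(k * j)) * appellLerch (ζ ^ j * x) q z
      = M / jTheta z q * ∑' r : ℤ, (-1 : ℂ) ^ r * q ^ choose2 r * z ^ r
          * (q ^ (r - 1) * (x * z)) ^ k / (1 - (q ^ (r - 1) * (x * z)) ^ M) := by
  have hζ0 : ζ ≠ 0 := hζ.ne_zero hM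
  have hs (j : ℕ) := ((summable_norm_lerchSum hq0 hq1
    (mul_ne_zero (mul_ne_zero (pow_ne_zero j hζ0) hx) hz) hz).of_norm).mul_left (ζ ^ (-(k * j)))
  have h1 (j : ℕ) : ζ ^ (-(k * j)) * appellLerch (ζ ^ j * x) q z
      = 1 / jTheta z q * ∑' r : ℤ, ζ ^ (-(k * j)) * ((-1 : ℂ) ^ r * q ^ choose2 r * z ^ r
        / (1 - q ^ (r - 1) * (ζ ^ j * x * z))) := by
    rw [appellLerch_eq_lerchSum, lerchSum, tsum_mul_left]
    ring
  simp_rw [h1]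
  rw [← Finset.mul_sum, ← Summable.tsum_finsetSum fun j _ => hs j, div_mul_eq_mul_div,
    div_mul_eq_mul_div, one_mul, ← tsum_mul_left]
  congr 1
  refine tsum_congr fun r => ?_
  have h2 := sum_root_filter hM hζ hk0 hkM (h (r - 1))
  trans (-1 : ℂ) ^ r * q ^ choose2 r * z ^ r * ∑ j ∈ Finset.range M, ζ ^ (-(k * j))
      / (1 - ζ ^ j * (q ^ (r - 1) * (x * z)))
  · rw [Finset.mul_sum]
    refine Finset.sum_congr rfl fun j _ => ?_
    rw [show q ^ (r - 1) * (ζ ^ j * x * z) = ζ ^ j * (q ^ (r - 1) * (x * z)) by ring]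
    ring
  · rw [h2]; ring

theorem average_appellLerch_eq {q ζ w : ℂ} (hq0 : q ≠ 0) (hq1 : ‖q‖ < 1) {M N : ℕ} (hM : M ≠ 0)
    (hN : N ≠ 0) (hζ : IsPrimitiveRoot ζ M) {k : ℤ} (hk0 : 0 ≤ k) (hkM : k < M)
    (hw : Generic ((-1) ^ (1 + N * M) * q ^ ((N : ℤ) ^ 2 * ((M : ℤ) ^ 2 - 2 * M * k)))
      (q ^ (2 * N ^ 2 * M ^ 2)) w) :
    1 / (M : ℂ) * ∑ j ∈ Finset.range M, ζ ^ (-(k * j))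
        * appellLerch (ζ ^ j * ((-1) ^ (N + 1) * q ^ N ^ 2)) (q ^ (2 * N ^ 2)) (-1)
      = (-1) ^ ((N : ℤ) * k) * q ^ (-((N : ℤ) ^ 2 * k ^ 2))
          * appellLerch ((-1) ^ (1 + N * M) * q ^ ((N : ℤ) ^ 2 * ((M : ℤ) ^ 2 - 2 * M * k)))
            (q ^ (2 * N ^ 2 * M ^ 2)) w
        + Psi k M ((-1) ^ (N + 1) * q ^ N ^ 2) (-1) w (q ^ (2 * N ^ 2)) := by
  have hQ : (q ^ (2 * N ^ 2)) ^ M ^ 2 = q ^ (2 * N ^ 2 * M ^ 2) := (pow_mul _ _ _).symm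
  have hQ0 : q ^ (2 * N ^ 2) ≠ 0 := pow_ne_zero _ hq0
  have hQ1 : ‖q ^ (2 * N ^ 2)‖ < 1 := norm_pow_lt_one hq1 (by positivity)
  set x : ℂ := (-1) ^ (N + 1) * q ^ N ^ 2 with hx
  have hx0 : x ≠ 0 := mul_ne_zero (pow_ne_zero _ (by norm_num)) (pow_ne_zero _ hq0)
  have hnx : -x = (-1) ^ N * q ^ N ^ 2 := by rw [hx]; ring
  have hNz : (0 : ℤ) < (N : ℤ) ^ 2 := by positivity
  have hzn (r : ℤ) : ‖(q ^ (2 * N ^ 2)) ^ r‖ = ‖q‖ ^ (2 * (N : ℤ) ^ 2 * r) := by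
    rw [norm_zpow, norm_pow, ← zpow_natCast, ← zpow_mul]
    push_cast
    rfl
  have hxn : ‖x * -1‖ = ‖q‖ ^ ((N : ℤ) ^ 2) := by
    rw [hx, ← Nat.cast_pow, zpow_natCast]; simp
  have hXeq : -((q ^ (2 * N ^ 2)) ^ (choose2 M - M * k) * (-x) ^ M)
      = (-1) ^ (1 + N * M) * q ^ ((N : ℤ) ^ 2 * ((M : ℤ) ^ 2 - 2 * M * k)) := by
    have e : (q ^ (2 * N ^ 2)) ^ (choose2 (M : ℤ) - M * k) * (q ^ N ^ 2) ^ M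
        = q ^ ((N : ℤ) ^ 2 * ((M : ℤ) ^ 2 - 2 * M * k)) := by
      rw [← pow_mul, ← zpow_natCast q (2 * N ^ 2), ← zpow_mul, ← zpow_natCast q (N ^ 2 * M),
        ← zpow_add₀ hq0]
      congr 1
      push_cast
      linear_combination (N : ℤ) ^ 2 * two_mul_choose2 M
    rw [hnx, mul_pow, ← e, ← pow_mul]
    ring
  have hpre : (q ^ (2 * N ^ 2)) ^ (-choose2 (k + 1)) * (-x) ^ k
      = (-1) ^ ((N : ℤ) * k) * q ^ (-((N : ℤ) ^ 2 * k ^ 2)) := by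
    rw [hnx, mul_zpow, ← zpow_natCast (-1 : ℂ) N, ← zpow_mul, mul_left_comm,
      ← zpow_natCast q (2 * N ^ 2), ← zpow_mul, ← zpow_natCast q (N ^ 2), ← zpow_mul,
      ← zpow_add₀ hq0]
    congr 2
    push_cast
    linear_combination (-(N : ℤ) ^ 2) * two_mul_choose2 (k + 1)
  have hm1 (r : ℤ) : (-1 : ℂ) ≠ (q ^ (2 * N ^ 2)) ^ r := by
    intro hr
    have h := congrArg norm hr
    rw [hzn, norm_neg, norm_one, ← zpow_zero ‖q‖] at h
    have h2 := zpow_norm_injective hq0 hq1 h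
    have h3 : r = 0 := by
      rcases mul_eq_zero.1 h2.symm with h | h
      · omega
      · exact h
    rw [h3, zpow_zero] at hr
    norm_num at hr
  -- The norm is |q| to an odd multiple of N²M, so no denominator can vanish.
  have hodd (r : ℤ) : ((q ^ (2 * N ^ 2)) ^ r * (x * -1)) ^ M ≠ 1 := by
    intro hr
    have h := congrArg norm hr
    rw [norm_pow, norm_mul, hzn, hxn, norm_one, ← zpow_add₀ (norm_ne_zero_iff.2 hq0),
      ← zpow_natCast, ← zpow_mul, ← zpow_zero ‖q‖] at h
    have h2 := zpow_norm_injective hq0 hq1 h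
    have h3 : (N : ℤ) ^ 2 * (M * (2 * r + 1)) = 0 := by linear_combination h2
    rcases mul_eq_zero.1 h3 with h | h
    · omega
    · rcases mul_eq_zero.1 h with h | h <;> omega
  have hmain := tsum_eq_appellLerch_add_Psi hQ0 hQ1 hx0 (by norm_num : (-1 : ℂ) ≠ 0) hm1 hM k
    (w := w) (by rw [hXeq, hQ]; exact hw) (fun t _ r hr => by
      have h := congrArg norm hr
      rw [← zpow_natCast (_ ^ _) (M * t), ← zpow_natCast (_ ^ _) (M ^ 2), ← zpow_mul _ _ r, norm_mul,
        norm_pow, hzn, hzn, hxn, ← zpow_natCast, ← zpow_mul,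
        ← zpow_add₀ (norm_ne_zero_iff.2 hq0)] at h
      have h2 := zpow_norm_injective hq0 hq1 h
      push_cast at h2
      have h3 : (N : ℤ) ^ 2 * (M * (2 * (t - M * r) + 1)) = 0 := by linear_combination h2
      rcases mul_eq_zero.1 h3 with h | h
      · omega
      · rcases mul_eq_zero.1 h with h | h <;> omega)
  have hj := jTheta_ne_zero hQ0 hQ1 (by norm_num : (-1 : ℂ) ≠ 0) hm1
  have hM' : (M : ℂ) ≠ 0 := by exact_mod_cast hM
  rw [sum_appellLerch_root hQ0 hQ1 hx0 (by norm_num) hM hζ hk0 hkM hodd, hmain, hpre, hXeq, hQ]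
  field_simp

theorem sum_zpow_mul_one_sub {ζ : ℂ} {M : ℕ} (hM : M ≠ 0) (hζ : IsPrimitiveRoot ζ M) {a : ℤ}
    (ha : 1 ≤ a) (haM : a ≤ (M : ℤ) - 1) :
    1 / (M : ℂ) * ∑ j ∈ Finset.range M, ζ ^ (-(a * j)) * (1 - ζ ^ j)
      = -(if a = 1 then 1 else 0) := by
  have hζ0 : ζ ≠ 0 := hζ.ne_zero hM
  have hM' : (M : ℂ) ≠ 0 := by exact_mod_cast hM
  have h1 (j : ℕ) : ζ ^ (-(a * j)) * (1 - ζ ^ j) = (ζ ^ (-a)) ^ j - (ζ ^ (1 - a)) ^ j := by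
    rw [← zpow_natCast (ζ ^ (-a)), ← zpow_natCast (ζ ^ (1 - a)), ← zpow_mul, ← zpow_mul,
      show (1 - a) * (j : ℤ) = -(a * j) + j by ring, zpow_add₀ hζ0, zpow_natCast, neg_mul]
    ring
  simp_rw [h1, Finset.sum_sub_distrib, sum_zpow_pow_eq hζ]
  rw [if_neg]
  · split_ifs with h2 h3 h3
    · field_simp; ring
    · have := Int.eq_zero_of_abs_lt_dvd h2 (by rw [abs_lt]; omega)
      omega
    · subst h3; simp at h2
    · simp
  · intro h
    have := Int.eq_zero_of_abs_lt_dvd h (by rw [abs_lt]; omega)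
    omega

theorem sum_Icc_eq_sum_range {M : ℕ} (hM : M ≠ 0) {f : ℕ → ℂ} (h0 : f 0 = 0) :
    ∑ j ∈ Finset.Icc 1 (M - 1), f j = ∑ j ∈ Finset.range M, f j := by
  rw [Finset.range_eq_Ico, Finset.sum_eq_sum_Ico_succ_bot (by omega), h0, zero_add]
  exact Finset.sum_congr (by ext; simp; omega) fun _ _ => rfl

/-- The sum of two consecutive rank deviations for `d = 2 N`, in terms of Appell--Lerch series and
theta quotients. -/
theorem Dbar_add_Dbar {M N : ℕ} {a : ℤ} (hN : N ≠ 0) (ha : 1 ≤ a) (haM : a ≤ (M : ℤ) - 1)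
    {q : ℂ} (hq0 : q ≠ 0) (hq1 : ‖q‖ < 1) {ζ : ℂ} (hζ : IsPrimitiveRoot ζ M) {w : ℕ → ℂ}
    (hw : ∀ j ∈ Finset.Icc 1 (M - 1), w j ^ N = ζ ^ j) {z₁ z₂ : ℂ}
    (hz₁ : Generic ((-1) ^ (1 + N * M) * q ^ ((N : ℤ) ^ 2 * ((M : ℤ) ^ 2 - 2 * M * a)))
      (q ^ (2 * N ^ 2 * M ^ 2)) z₁)
    (hz₂ : Generic ((-1) ^ (1 + N * M) * q ^ ((N : ℤ) ^ 2 * ((M : ℤ) ^ 2 - 2 * M * (a - 1))))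
      (q ^ (2 * N ^ 2 * M ^ 2)) z₂) :
    Dbar (2 * N) a M q + Dbar (2 * N) (a - 1) M q =
      (if a = 1 then 1 else 0)
      + 2 * ((-1) ^ ((N : ℤ) * a) * q ^ (-((N : ℤ) ^ 2 * a ^ 2))
          * appellLerch ((-1) ^ (1 + N * M) * q ^ ((N : ℤ) ^ 2 * ((M : ℤ) ^ 2 - 2 * M * a)))
            (q ^ (2 * N ^ 2 * M ^ 2)) z₁
        + Psi a M ((-1) ^ (N + 1) * q ^ N ^ 2) (-1) z₁ (q ^ (2 * N ^ 2)))
      - 2 * ((-1) ^ ((N : ℤ) * (a - 1)) * q ^ (-((N : ℤ) ^ 2 * (a - 1) ^ 2))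
          * appellLerch ((-1) ^ (1 + N * M) * q ^ ((N : ℤ) ^ 2 * ((M : ℤ) ^ 2 - 2 * M * (a - 1))))
            (q ^ (2 * N ^ 2 * M ^ 2)) z₂
        + Psi (a - 1) M ((-1) ^ (N + 1) * q ^ N ^ 2) (-1) z₂ (q ^ (2 * N ^ 2)))
      + 2 / (M : ℂ) * (-1) ^ N * q ^ (-(N : ℤ) ^ 2)
        * ∑ j ∈ Finset.Icc 1 (M - 1), ζ ^ ((j : ℤ) - a * j) * (1 - ζ ^ j)
            * Psi 0 N (w j * q ^ (1 - ((2 * N : ℕ) : ℤ))) q (-1) (q ^ 2) := by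
  have hM : M ≠ 0 := by omega
  have hd : 2 * N ≠ 0 := by omega
  have hζ0 : ζ ≠ 0 := hζ.ne_zero hM
  have hζ1 : ‖ζ‖ = 1 := hζ.norm'_eq_one hM
  rw [Dbar, Dbar, (hasSum_devCoeff hq1 hM hζ hd a).tsum_eq,
    (hasSum_devCoeff hq1 hM hζ hd (a - 1)).tsum_eq,
    ← average_appellLerch_eq hq0 hq1 hM hN hζ (by omega : 0 ≤ a) (by omega) hz₁,
    ← average_appellLerch_eq hq0 hq1 hM hN hζ (by omega : 0 ≤ a - 1) (by omega) hz₂]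
  have h1 := sum_zpow_mul_one_sub hM hζ ha haM
  set x : ℂ := (-1) ^ (N + 1) * q ^ N ^ 2
  have hpow (j : ℕ) : ζ ^ (-((a - 1) * j)) = ζ ^ (-(a * j)) * ζ ^ j := by
    rw [← zpow_natCast ζ j, ← zpow_add₀ hζ0]; congr 1; ring
  -- The two deviations combine through ζ^(-aj)(1 + ζ^j), exactly the factor for which the bilateral
  -- formula is available.
  have hterm : ∀ j ∈ Finset.Icc 1 (M - 1), ζ ^ (-(a * j)) * rankValue (2 * N) (ζ ^ j) q
      + ζ ^ (-((a - 1) * j)) * rankValue (2 * N) (ζ ^ j) q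
      = 2 * (ζ ^ (-(a * j)) * (1 - ζ ^ j) * appellLerch (ζ ^ j * x) (q ^ (2 * N ^ 2)) (-1))
        - ζ ^ (-(a * j)) * (1 - ζ ^ j)
        + 2 * (-1) ^ N * q ^ (-(N : ℤ) ^ 2) * (ζ ^ ((j : ℤ) - a * j) * (1 - ζ ^ j)
            * Psi 0 N (w j * q ^ (1 - ((2 * N : ℕ) : ℤ))) q (-1) (q ^ 2)) := by
    intro j hj
    have hj' := Finset.mem_Icc.1 hj
    have hn : ‖ζ ^ j‖ = 1 := by rw [norm_pow, hζ1, one_pow]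
    have hne : ζ ^ j ≠ 1 := hζ.pow_ne_one_of_pos_of_lt (by omega) (by omega)
    have e1 := one_add_mul_rankValue hq0 hq1 hn hne hd
    rw [rankSum_div_eq hq0 hq1 hn hne hN (hw j hj)] at e1
    have e2 : ζ ^ ((j : ℤ) - a * j) = ζ ^ (-(a * j)) * ζ ^ j := by
      rw [← zpow_natCast ζ j, ← zpow_add₀ hζ0]; congr 1; ring
    rw [hpow, e2]
    linear_combination ζ ^ (-(a * j)) * e1
  -- The factor 1 - ζ^j vanishes at j = 0, so these sums extend to all M-th roots of unity;
  -- expanding it below gives the averages for k = a minus those for k = a - 1.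
  rw [← mul_add, ← Finset.sum_add_distrib, Finset.sum_congr rfl hterm, Finset.sum_add_distrib,
    Finset.sum_sub_distrib, ← Finset.mul_sum, ← Finset.mul_sum,
    sum_Icc_eq_sum_range hM (f := fun j => ζ ^ (-(a * j)) * (1 - ζ ^ j)) (by simp),
    sum_Icc_eq_sum_range hM (f := fun j => ζ ^ (-(a * j)) * (1 - ζ ^ j)
      * appellLerch (ζ ^ j * x) (q ^ (2 * N ^ 2)) (-1)) (by simp)]
  have h2 : ∑ j ∈ Finset.range M, ζ ^ (-(a * j)) * (1 - ζ ^ j)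
        * appellLerch (ζ ^ j * x) (q ^ (2 * N ^ 2)) (-1)
      = ∑ j ∈ Finset.range M, ζ ^ (-(a * j)) * appellLerch (ζ ^ j * x) (q ^ (2 * N ^ 2)) (-1)
        - ∑ j ∈ Finset.range M, ζ ^ (-((a - 1) * j))
          * appellLerch (ζ ^ j * x) (q ^ (2 * N ^ 2)) (-1) := by
    rw [← Finset.sum_sub_distrib]
    refine Finset.sum_congr rfl fun j _ => ?_
    rw [hpow]; ring
  rw [h2]
  linear_combination -h1

end OverpartitionRank

theorem theorem1p2
    (d M : ℕ) (a : ℤ) (hd : 2 ≤ d) (hd_even : Even d) (ha : 1 ≤ a) (haM : a ≤ (M : ℤ) - 1)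
    (q : ℂ) (hq0 : q ≠ 0) (hq1 : ‖q‖ < 1)
    (ζ : ℂ) (hζ : IsPrimitiveRoot ζ M)
    (w : ℕ → ℂ) (hw : ∀ j ∈ Finset.Icc 1 (M - 1), w j ^ (d / 2) = ζ ^ j)
    (z₁ z₂ : ℂ)
    (hz₁ : OverpartitionRank.Generic
      ((-1) ^ (1 + d * M / 2) * q ^ ((d : ℤ) ^ 2 / 4 * ((M : ℤ) ^ 2 - 2 * M * a)))
      (q ^ (d ^ 2 * M ^ 2 / 2)) z₁)
    (hz₂ : OverpartitionRank.Generic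
      ((-1) ^ (1 + d * M / 2) * q ^ ((d : ℤ) ^ 2 / 4 * ((M : ℤ) ^ 2 - 2 * M * (a - 1))))
      (q ^ (d ^ 2 * M ^ 2 / 2)) z₂) :
    Summable (fun n : ℕ => OverpartitionRank.devCoeff d a M n * q ^ n) ∧
    Summable (fun n : ℕ => OverpartitionRank.devCoeff d (a - 1) M n * q ^ n) ∧
    OverpartitionRank.Dbar d a M q + OverpartitionRank.Dbar d (a - 1) M q =
      (if a = 1 then 1 else 0)
      + 2 * (-1) ^ ((d : ℤ) * a / 2) * q ^ (-((d : ℤ) ^ 2 * a ^ 2 / 4))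
        * OverpartitionRank.appellLerch
            ((-1) ^ (1 + d * M / 2) * q ^ ((d : ℤ) ^ 2 / 4 * ((M : ℤ) ^ 2 - 2 * M * a)))
            (q ^ (d ^ 2 * M ^ 2 / 2)) z₁
      + 2 * (-1) ^ ((d : ℤ) / 2 * (a - 1) + 1)
        * q ^ (-((d : ℤ) ^ 2 / 4 * (a ^ 2 - 2 * a + 1)))
        * OverpartitionRank.appellLerch
            ((-1) ^ (1 + d * M / 2) * q ^ ((d : ℤ) ^ 2 / 4 * ((M : ℤ) ^ 2 - 2 * M * (a - 1))))
            (q ^ (d ^ 2 * M ^ 2 / 2)) z₂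
      + 2 * OverpartitionRank.Psi a M ((-1) ^ (d / 2 + 1) * q ^ (d ^ 2 / 4)) (-1) z₁
          (q ^ (d ^ 2 / 2))
      - 2 * OverpartitionRank.Psi (a - 1) M ((-1) ^ (d / 2 + 1) * q ^ (d ^ 2 / 4)) (-1) z₂
          (q ^ (d ^ 2 / 2))
      + 2 / (M : ℂ) * (-1) ^ (d / 2) * q ^ (-((d : ℤ) ^ 2 / 4))
        * ∑ j ∈ Finset.Icc 1 (M - 1), ζ ^ ((j : ℤ) - a * j) * (1 - ζ ^ j)
            * OverpartitionRank.Psi 0 (d / 2) (w j * q ^ (1 - (d : ℤ))) q (-1) (q ^ 2) := by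
  obtain ⟨N, rfl⟩ : ∃ N, d = 2 * N := hd_even.two_dvd
  have hN : N ≠ 0 := by omega
  -- The divisions of ℕ and ℤ in the statement are truncating; d = 2N makes each of them exact.
  have e1 : 2 * N / 2 = N := by omega
  have e2 : 2 * N * M / 2 = N * M := by rw [mul_assoc]; omega
  have e3 : (2 * N) ^ 2 / 4 = N ^ 2 := by
    rw [show (2 * N) ^ 2 = 4 * N ^ 2 by ring]; omega
  have e4 : (2 * N) ^ 2 / 2 = 2 * N ^ 2 := by
    rw [show (2 * N) ^ 2 = 2 * (2 * N ^ 2) by ring]; omega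
  have e5 : (2 * N) ^ 2 * M ^ 2 / 2 = 2 * N ^ 2 * M ^ 2 := by
    rw [show (2 * N) ^ 2 * M ^ 2 = 2 * (2 * N ^ 2 * M ^ 2) by ring]; omega
  have f1 : ((2 * N : ℕ) : ℤ) / 2 = N := by omega
  have f2 : ((2 * N : ℕ) : ℤ) * a / 2 = N * a := by
    rw [show ((2 * N : ℕ) : ℤ) * a = 2 * (N * a) by push_cast; ring]; omega
  have f3 : ((2 * N : ℕ) : ℤ) ^ 2 / 4 = (N : ℤ) ^ 2 := by
    rw [show ((2 * N : ℕ) : ℤ) ^ 2 = 4 * (N : ℤ) ^ 2 by push_cast; ring]; omega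
  have f4 : ((2 * N : ℕ) : ℤ) ^ 2 * a ^ 2 / 4 = (N : ℤ) ^ 2 * a ^ 2 := by
    rw [show ((2 * N : ℕ) : ℤ) ^ 2 * a ^ 2 = 4 * ((N : ℤ) ^ 2 * a ^ 2) by push_cast; ring]; omega
  rw [e1] at hw
  rw [e2, e5, f3] at hz₁ hz₂
  have hM : M ≠ 0 := by omega
  refine ⟨(OverpartitionRank.hasSum_devCoeff hq1 hM hζ (by omega) a).summable,
    (OverpartitionRank.hasSum_devCoeff hq1 hM hζ (by omega) (a - 1)).summable, ?_⟩
  rw [OverpartitionRank.Dbar_add_Dbar hN ha haM hq0 hq1 hζ hw hz₁ hz₂, e1, e2, e3, e4, e5, f1, f2,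
    f3, f4, zpow_add_one₀ (by norm_num), show a ^ 2 - 2 * a + 1 = (a - 1) ^ 2 by ring]
  ring
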